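/- Let $\mathcal H,\mathcal K$ be finite dimensional Hilbert spaces and let $\mathcal A\subseteq B(\mathcal H)$, $\mathcal B\subseteq B(\mathcal K)$ be $C^*$-algebras containing the identity operators. A density operator in $\mathcal A$ is a positive $\rho\in\mathcal A$ with $\operatorname{Tr}\rho=1$. For a linear map $T:\mathcal A\to\mathcal B$ let $T^*:\mathcal B\to\mathcal A$ be its adjoint with respect to the Hilbert-Schmidt inner products $\langle a,b\rangle=\operatorname{Tr}a^*b$. A linear map $\Phi$ is a unital Schwarz map if $\Phi(I)=I$ and $\Phi(a^*a)\ge\Phi(a)^*\Phi(a)$ for all $a$. Let $\mathcal S$ be a set of density operators in $\mathcal A$, let $T:\mathcal A\to\mathcal B$ be linear, and assume: 1. $\mathcal S$ contains an invertible element $\rho$, and $T(\rho)$ is invertible as well; 2. $T^*$ and $T_\rho:\mathcal A\to\mathcal B$, $T_\rho(b)=T(\rho)^{-1/2}\,T(\rho^{1/2}b\rho^{1/2})\,T(\rho)^{-1/2}$, are unital Schwarz maps. $T$ is called reversible for $\mathcal S$ if there is a linear map $S:\mathcal B\to\mathcal A$ such that $S^*$ is a unital Schwarz map and $S(T(\sigma))=\sigma$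 for all $\sigma\in\mathcal S$. Let $\mathrm{Lin}(\mathcal S)$ be the real linear span of $\{\sigma_1-\sigma_2:\sigma_1,\sigma_2\in\mathcal S\}$. A monotone metric assigns to every finite dimensional $C^*$-algebra of operators $\mathcal C$ a (smooth) Riemannian metric $\lambda$ on the manifold of invertible density operators in $\mathcal C$ (whose tangent space at each point consists of the traceless self-adjoint elements of $\mathcal C$), such that $\lambda_{\omega}(x,x)\ge\lambda_{\Psi(\omega)}(\Psi(x),\Psi(x))$ for every completely positive trace preserving map $\Psi:\mathcal C\to\mathcal C'$, all invertible density operators $\omega$ with $\Psi(\omega)$ invertible, and all tangent vectors $x$. For an operator monotone function $f:(0,\infty)\to(0,\infty)$ that is symmetric, i.e. $f(t)=tf(t^{-1})$, and an invertible density operator $\omega$, put $J^f_\omega=f(\Delta_\omega)R_\omega$, where $R_\omega(x)=x\omega$ and $\Delta_\omega(x)=\omega x\omega^{-1}$, and $$\lambda^f_\omega(x,y)=\operatorname{Tr}\,(J^f_\omega)^{-1}(x)\,y,\qquad \chi^2_{1/f}(\sigma,\omega)=\lambda^f_\omega(\sigma-\omega,\sigma-\omega).$$ A representing measure of $f$ is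 a positive Borel measure $\nu_f$ on $[0,\infty)$ such that, for some constant $c\ge 0$, $\;1/f(t)=c+\int_{[0,\infty)}\frac{1}{s+t}\,d\nu_f(s)$ for all $t>0$. Then the following are equivalent: (i) $T$ is reversible for $\mathcal S$. (ii) $\lambda_\rho(x,x)=\lambda_{T(\rho)}(T(x),T(x))$ for all $x\in\mathrm{Lin}(\mathcal S)$ and all monotone metrics $\lambda$. (ii') $\lambda^f_\rho(x,x)=\lambda^f_{T(\rho)}(T(x),T(x))$ for all $x\in\mathrm{Lin}(\mathcal S)$ and all symmetric operator monotone $f:(0,\infty)\to(0,\infty)$. (iii) $\chi^2_{1/f}(\sigma,\rho)=\chi^2_{1/f}(T(\sigma),T(\rho))$ for all $\sigma\in\mathcal S$ and all symmetric operator monotone $f:(0,\infty)\to(0,\infty)$. (iv) There is a symmetric operator monotone $f:(0,\infty)\to(0,\infty)$ with a representing measure whose support has at least $\dim(\mathcal H)^2+\dim(\mathcal K)^2$ points such that the equality in (ii') holds for all $x\in\mathrm{Lin}(\mathcal S)$. (v) There is a function $f$ as in (iv) such that the equality in (iii) holds for all $\sigma\in\mathcal S$. -/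

import Mathlib

open scoped Kronecker ContDiff ComplexOrder

namespace QuantumReversibility

/-- Operators on the Hilbert space `ℂⁿ`. -/
abbrev Op (n : ℕ) := Matrix (Fin n) (Fin n) ℂ

/-- C*-algebras of operators on `ℂⁿ` (containing the identity operator). -/
abbrev Alg (n : ℕ) := StarSubalgebra ℂ (Op n)

section Adjoint

variable {n m : ℕ} {A : Alg n} {B : Alg m}

/-- The Hilbert-Schmidt inner product `⟨a, b⟩ = Tr a⋆ b`. -/
def hs (a b : A) : ℂ := ((star a * b : A) : Op n).trace

lemma hs_self_eq (a : A) : hs a a = ∑ j, ∑ i, ((‖(a : Op n) i j‖ ^ 2 : ℝ) : ℂ) := by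
  simp only [hs, MulMemClass.coe_mul, StarMemClass.coe_star, Matrix.trace, Matrix.diag,
    Matrix.mul_apply, Matrix.star_apply]
  refine Finset.sum_congr rfl fun j _ => Finset.sum_congr rfl fun i _ => ?_
  rw [RCLike.star_def, Complex.conj_mul']
  push_cast
  rfl

lemma eq_zero_of_hs_self {a : A} (h : hs a a = 0) : a = 0 := by
  rw [hs_self_eq] at h
  have h' : ∑ j, ∑ i, (‖(a : Op n) i j‖ ^ 2 : ℝ) = 0 := by exact_mod_cast h
  rw [Finset.sum_eq_zero_iff_of_nonneg
    (fun j _ => Finset.sum_nonneg fun i _ => sq_nonneg _)] at h'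
  refine Subtype.ext (Matrix.ext fun i j => ?_)
  have hj := h' j (Finset.mem_univ _)
  rw [Finset.sum_eq_zero_iff_of_nonneg (fun i _ => sq_nonneg _)] at hj
  have := hj i (Finset.mem_univ _)
  simpa using this

instance : FiniteDimensional ℂ A :=
  inferInstanceAs (FiniteDimensional ℂ (Subalgebra.toSubmodule A.toSubalgebra))

lemma isClosed_alg (A : Alg n) : IsClosed (A : Set (Op n)) :=
  Submodule.closed_of_finiteDimensional (Subalgebra.toSubmodule A.toSubalgebra)

/-- Every linear functional on `A` is of the form `⟨a, ·⟩`. -/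
lemma exists_riesz (φ : A →ₗ[ℂ] ℂ) : ∃ a : A, ∀ x, hs a x = φ x := by
  let D : A →ₗ[ℂ] Module.Dual ℂ A :=
    { toFun := fun a =>
        { toFun := fun x => ((a * x : A) : Op n).trace
          map_add' := fun x y => by simp [mul_add, Matrix.trace_add]
          map_smul' := fun c x => by simp [Matrix.trace_smul] }
      map_add' := fun a b => by
        ext x
        simp [add_mul, Matrix.trace_add]
      map_smul' := fun c a => by
        ext x
        simp [Matrix.trace_smul] }
  have hD : Function.Injective D := by
    rw [injective_iff_map_eq_zero]
    intro a ha
    have h1 : D a (star a) = 0 := by rw [ha]; rfl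
    have h2 : hs (star a) (star a) = 0 := by
      simpa [hs, D] using h1
    have h3 := eq_zero_of_hs_self h2
    simpa using congrArg star h3
  have hsurj : Function.Surjective D :=
    (LinearMap.injective_iff_surjective_of_finrank_eq_finrank
      (Subspace.dual_finrank_eq (K := ℂ) (V := A)).symm).1 hD
  obtain ⟨a, ha⟩ := hsurj φ
  refine ⟨star a, fun x => ?_⟩
  rw [← ha]
  simp [hs, D]

lemma hs_left_injective {a b : A} (h : ∀ x, hs a x = hs b x) : a = b := by
  have h1 := h (a - b)
  have h2 : hs (a - b) (a - b) = 0 := by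
    have : hs (a - b) (a - b) = hs a (a - b) - hs b (a - b) := by
      simp [hs, sub_mul, Matrix.trace_sub]
    rw [this, h1, sub_self]
  exact sub_eq_zero.1 (eq_zero_of_hs_self h2)

lemma exists_hsAdjoint (T : A →ₗ[ℂ] B) :
    ∃ T' : B →ₗ[ℂ] A, ∀ b a, hs (T' b) a = hs b (T a) := by
  have key : ∀ b : B, ∃ a' : A, ∀ a, hs a' a = hs b (T a) := fun b =>
    exists_riesz
      { toFun := fun a => hs b (T a)
        map_add' := fun x y => by simp [hs, mul_add, Matrix.trace_add]
        map_smul' := fun c x => by simp [hs, Matrix.trace_smul] }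
  choose F hF using key
  refine ⟨{ toFun := F, map_add' := fun x y => ?_, map_smul' := fun c x => ?_ }, hF⟩
  · refine hs_left_injective fun a => ?_
    have : hs (F x + F y) a = hs (F x) a + hs (F y) a := by
      simp [hs, add_mul, Matrix.trace_add]
    rw [this, hF, hF, hF]
    simp [hs, add_mul, Matrix.trace_add]
  · refine hs_left_injective fun a => ?_
    have : hs (c • F x) a = star c * hs (F x) a := by
      simp [hs, Matrix.trace_smul]
    rw [RingHom.id_apply, this, hF, hF]
    simp [hs, Matrix.trace_smul]

/-- The adjoint `T⋆ : B → A` of a linear map `T : A → B` with respect to the Hilbert-Schmidt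
inner products. -/
noncomputable def hsAdjoint (T : A →ₗ[ℂ] B) : B →ₗ[ℂ] A := (exists_hsAdjoint T).choose

/-- The defining property `⟨T⋆ b, a⟩ = ⟨b, T a⟩` of the adjoint. -/
lemma hs_hsAdjoint (T : A →ₗ[ℂ] B) (b : B) (a : A) : hs (hsAdjoint T b) a = hs b (T a) :=
  (exists_hsAdjoint T).choose_spec b a

end Adjoint

section Maps

variable {n m : ℕ} {A : Alg n} {B : Alg m}

/-- Unital Schwarz maps: `Φ 1 = 1` and `Φ (a⋆ a) ≥ (Φ a)⋆ (Φ a)` for all `a`. -/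
def IsUnitalSchwarz (Φ : A →ₗ[ℂ] B) : Prop :=
  Φ 1 = 1 ∧
    ∀ a : A, ((Φ (star a * a) - star (Φ a) * Φ a : B) : Op m).PosSemidef

/-- Completely positive maps: for every `k` the map `id ⊗ Φ` on `k × k` block matrices with
entries in the algebra preserves positivity. -/
def IsCompletelyPositive (Φ : A →ₗ[ℂ] B) : Prop :=
  ∀ (k : ℕ) (a : Matrix (Fin k) (Fin k) A),
    (Matrix.comp (Fin k) (Fin k) (Fin n) (Fin n) ℂ (a.map fun x => (x : Op n))).PosSemidef →
    (Matrix.comp (Fin k) (Fin k) (Fin m) (Fin m) ℂ (a.map fun x => (Φ x : Op m))).PosSemidef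

/-- Trace preserving maps. -/
def IsTracePreserving (Φ : A →ₗ[ℂ] B) : Prop :=
  ∀ a : A, (Φ a : Op m).trace = (a : Op n).trace

/-- Density operators in `A`. -/
def IsDensity (ρ : A) : Prop := (ρ : Op n).PosSemidef ∧ (ρ : Op n).trace = 1

/-- Reversibility of `T` for a set `S` of density operators. -/
def IsReversible (T : A →ₗ[ℂ] B) (S : Set A) : Prop :=
  ∃ R : B →ₗ[ℂ] A, IsUnitalSchwarz (hsAdjoint R) ∧ ∀ σ ∈ S, R (T σ) = σ

/-- A function of an operator in `A`, by the functional calculus; it stays in `A`. -/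
noncomputable def fc (f : ℝ → ℝ) (a : A) : A :=
  ⟨cfc f (a : Op n), by
    have : IsClosed (A : Set (Op n)) := isClosed_alg A
    exact cfc_mem f a.2⟩

/-- The map `T_ρ b = T(ρ)^{-1/2} T(ρ^{1/2} b ρ^{1/2}) T(ρ)^{-1/2}`, for `ρ` and `T ρ` positive and
invertible. -/
noncomputable def petzDual (T : A →ₗ[ℂ] B) (ρ : A) : A →ₗ[ℂ] B where
  toFun b := fc (fun t => (Real.sqrt t)⁻¹) (T ρ) * T (fc Real.sqrt ρ * b * fc Real.sqrt ρ) *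
    fc (fun t => (Real.sqrt t)⁻¹) (T ρ)
  map_add' x y := by simp only [mul_add, add_mul, map_add]
  map_smul' c x := by simp only [mul_smul_comm, smul_mul_assoc, map_smul, RingHom.id_apply]

/-- `Lin(S)`, the real span of the differences of elements of `S`. -/
def Lin (S : Set A) : Submodule ℝ A :=
  Submodule.span ℝ {x | ∃ σ₁ ∈ S, ∃ σ₂ ∈ S, x = σ₁ - σ₂}

/-- The tangent space of the manifold of invertible density operators in `A`: the traceless
self-adjoint elements. -/
def IsTangent (x : A) : Prop := IsSelfAdjoint x ∧ (x : Op n).trace = 0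

end Maps

/-- A monotone metric: to each algebra `A` a Riemannian metric on the manifold of invertible
density operators in `A` is assigned, such that the metric does not increase under completely
positive trace preserving maps. The value `g n A ρ x y` is the inner product of the tangent vectors
`x` and `y` at the point `ρ`; the values for other `ρ`, `x`, `y` are irrelevant. -/
structure IsMonotoneMetric (g : ∀ (n : ℕ) (A : Alg n), A → A → A → ℝ) : Prop where
  add_left : ∀ (n : ℕ) (A : Alg n) (ρ : A), IsDensity ρ → IsUnit ρ →
    ∀ x y z : A, IsTangent x → IsTangent y → IsTangent z →
      g n A ρ (x + y) z = g n A ρ x z + g n A ρ y z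
  smul_left : ∀ (n : ℕ) (A : Alg n) (ρ : A), IsDensity ρ → IsUnit ρ →
    ∀ (c : ℝ) (x y : A), IsTangent x → IsTangent y → g n A ρ (c • x) y = c * g n A ρ x y
  symm : ∀ (n : ℕ) (A : Alg n) (ρ : A), IsDensity ρ → IsUnit ρ →
    ∀ x y : A, IsTangent x → IsTangent y → g n A ρ x y = g n A ρ y x
  pos : ∀ (n : ℕ) (A : Alg n) (ρ : A), IsDensity ρ → IsUnit ρ →
    ∀ x : A, IsTangent x → x ≠ 0 → 0 < g n A ρ x x
  smooth : ∀ (n : ℕ) (A : Alg n) (ρ : A), IsDensity ρ → IsUnit ρ →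
    ∀ x y : A, IsTangent x → IsTangent y →
    ∀ (k : ℕ) (z : Fin k → A), (∀ i, IsTangent (z i)) →
      ContDiffAt ℝ ∞ (fun u : Fin k → ℝ => g n A (ρ + ∑ i, u i • z i) x y) 0
  monotone : ∀ (n m : ℕ) (A : Alg n) (B : Alg m) (T : A →ₗ[ℂ] B),
    IsCompletelyPositive T → IsTracePreserving T →
    ∀ ρ : A, IsDensity ρ → IsUnit ρ → IsUnit (T ρ) →
    ∀ x : A, IsTangent x → g m B (T ρ) (T x) (T x) ≤ g n A ρ x x

section Functions

/-- Operator monotone functions on `(0, ∞)`: `f(a) ≤ f(b)` for all positive definite matrices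
`a ≤ b` of any size. The values of `f` outside `(0, ∞)` are irrelevant. -/
def IsOperatorMonotone (f : ℝ → ℝ) : Prop :=
  ∀ (k : ℕ) (a b : Op k), a.PosDef → b.PosDef → (b - a).PosSemidef →
    (cfc f b - cfc f a).PosSemidef

/-- Symmetric positive operator monotone functions on `(0, ∞)`. -/
structure IsSymmOperatorMonotone (f : ℝ → ℝ) : Prop where
  pos : ∀ t, 0 < t → 0 < f t
  symm : ∀ t, 0 < t → f t = t * f t⁻¹
  operatorMonotone : IsOperatorMonotone f

/-- `ν`, a positive measure on `[0, ∞)`, represents `f`: for some constant `c ≥ 0`,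
`1 / f(t) = c + ∫ (s + t)⁻¹ dν(s)` for all `t > 0`. -/
def IsRepresentingMeasure (f : ℝ → ℝ) (ν : MeasureTheory.Measure ℝ) : Prop :=
  ν (Set.Iio 0) = 0 ∧ ∃ c : ℝ, 0 ≤ c ∧ ∀ t, 0 < t →
    MeasureTheory.Integrable (fun s => (s + t)⁻¹) ν ∧ (f t)⁻¹ = c + ∫ s, (s + t)⁻¹ ∂ν

end Functions

section Metric

variable {n : ℕ}

/-- The matrix, in the standard basis of `B(ℂⁿ)`, of the modular operator
`Δ_ρ : x ↦ ρ x ρ⁻¹`. -/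
noncomputable def modular (ρ : Op n) : Matrix (Fin n × Fin n) (Fin n × Fin n) ℂ :=
  (ρ⁻¹).transpose ⊗ₖ ρ

lemma modular_mulVec (ρ x : Op n) : (modular ρ).mulVec x.vec = (ρ * x * ρ⁻¹).vec := by
  rw [modular, Matrix.kronecker_mulVec_vec, Matrix.transpose_transpose]

/-- The matrix of the operator `R_ρ : x ↦ x ρ`. -/
noncomputable def rightMul (ρ : Op n) : Matrix (Fin n × Fin n) (Fin n × Fin n) ℂ :=
  ρ.transpose ⊗ₖ (1 : Op n)

lemma rightMul_mulVec (ρ x : Op n) : (rightMul ρ).mulVec x.vec = (x * ρ).vec := by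
  rw [rightMul, Matrix.kronecker_mulVec_vec, Matrix.transpose_transpose, one_mul]

/-- The matrix of the operator `J = f(Δ_ρ) R_ρ`. -/
noncomputable def J (f : ℝ → ℝ) (ρ : Op n) : Matrix (Fin n × Fin n) (Fin n × Fin n) ℂ :=
  cfc f (modular ρ) * rightMul ρ

/-- The operator `J⁻¹`. -/
noncomputable def JInv (f : ℝ → ℝ) (ρ x : Op n) : Op n :=
  Matrix.of fun i j => ((J f ρ)⁻¹.mulVec x.vec) (j, i)

/-- The metric `λ_ρ(x, y) = Tr J⁻¹(x) y` given by the function `f`. If `ρ` belongs to an algebra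
`A`, then `A` is an invariant subspace of `Δ_ρ`, `R_ρ` and `J`, so that for `x`, `y` in `A` this is
the same for the operators on `A` as for the operators on `B(ℂⁿ)`. -/
noncomputable def metric (f : ℝ → ℝ) (ρ x y : Op n) : ℂ := (JInv f ρ x * y).trace

/-- The quantum `χ²`-divergence of `σ` and `ρ` given by the function `f`. -/
noncomputable def chiSq (f : ℝ → ℝ) (σ ρ : Op n) : ℂ := metric f ρ (σ - ρ) (σ - ρ)

end Metric

end QuantumReversibility

open QuantumReversibility

/-
For `s ≥ 0` let `invForm s ρ` be the quadratic form of `(s R_ρ + L_ρ)⁻¹`, that is, `λ_ρ` for the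
function `t ↦ s + t`. Each of these forms is a monotone metric and decreases under `T`, and every
statement in the list reduces to: `T` preserves all of them on `σ - ρ`, for `σ ∈ S`.

Let `τ = T ρ`, `a = (s R_ρ + L_ρ)⁻¹ x` and `b = (s R_τ + L_τ)⁻¹ (T x)`. The decrease of the form
is a definite form of `a - T* b` plus the traces against `ρ` of `s` times the Schwarz defect of `T*`
at `b` and of its Schwarz defect at `b⋆`. So if the form is preserved, then `T* b = a`, and if
`s > 0` then both defects vanish, which puts `(b, a)` in the graph of `T*` over its multiplicative
domain.

For a single `f` the difference of the two sides is a nonnegative constant plus the integral of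
these decreases against the representing measure. If it is zero, all forms at points of its support
are preserved. In `B × A` the pairs `(b, a)` are resolvents of the modular operator of `(τ, ρ)`
applied to `(T x τ⁻¹, x ρ⁻¹)`, and `dim (B × A)` of them span the cyclic subspace. Hence the graph
of `T*` contains all of them, and all forms are preserved.

In that case `(T x τ⁻¹, x ρ⁻¹)` belongs to the largest star subalgebra `G` of the graph over the
multiplicative domain that is invariant under conjugation by `(τ, ρ)`. As in Takesaki's theorem,
invariance makes the state preserving projections onto the two factors of `G` completely positive.
Passing from one factor to the other, they are the adjoints of channels that agree with `T` at `x`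
and recover `x` from `T x`. Finally the square root has a representing measure with support
`[0, ∞)`, so the existential statements follow from the universal ones.
-/

namespace QuantumReversibility

section CyclicSubspaces

open Polynomial Lagrange

variable {K V : Type*} [Field K] [AddCommGroup V] [Module K V]

/-- The largest subspace of `W` that is invariant under `D`. -/
noncomputable def invariantCore (D : Module.End K V) (W : Submodule K V) : Submodule K V :=
  ⨅ p : K[X], W.comap (aeval D p)

variable {D : Module.End K V} {W : Submodule K V}

lemma mem_invariantCore {v : V} : v ∈ invariantCore D W ↔ ∀ p : K[X], aeval D p v ∈ W := by
  simp only [invariantCore, Submodule.mem_iInf, Submodule.mem_comap]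

lemma invariantCore_le : invariantCore D W ≤ W := fun v hv => by
  simpa only [map_one, Module.End.one_apply] using mem_invariantCore.1 hv 1

lemma aeval_mem_invariantCore (p : K[X]) {v : V} (hv : v ∈ invariantCore D W) :
    aeval D p v ∈ invariantCore D W :=
  mem_invariantCore.2 fun q => by
    simpa only [map_mul, Module.End.mul_apply] using mem_invariantCore.1 hv (q * p)

lemma mem_invariantCore_of_aeval_mem [FiniteDimensional K V] {q : K[X]}
    (hq : Function.Injective (aeval D q)) {v : V} (hv : aeval D q v ∈ invariantCore D W) :
    v ∈ invariantCore D W := by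
  let E := (aeval D q).restrict fun v (hv : v ∈ invariantCore D W) => aeval_mem_invariantCore q hv
  have hE : Function.Injective E := fun v w h => Subtype.ext (hq (congrArg Subtype.val h))
  obtain ⟨w, hw⟩ := LinearMap.surjective_of_injective hE ⟨aeval D q v, hv⟩
  have hwv : aeval D q w = aeval D q v := congrArg Subtype.val hw
  exact hq hwv ▸ w.2

lemma aeval_nodal_injective {s : Finset K}
    (h : ∀ z ∈ s, Function.Injective fun v => D v - z • v) :
    Function.Injective (aeval D (nodal s id)) := by
  rw [nodal_eq]
  refine Finset.prod_induction _ (fun q => Function.Injective (aeval D q))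
    (fun p q hp hq => ?_) ?_ fun z hz => ?_
  · rw [map_mul]
    exact hp.comp hq
  · rw [map_one]
    exact Function.injective_id
  · convert h z hz using 2
    simp [Module.algebraMap_end_apply]

lemma exists_eq_sum_nodal_erase [DecidableEq K] {s : Finset K} {r : K[X]}
    (h : r.degree < s.card) : ∃ c : K → K, r = ∑ z ∈ s, C (c z) * nodal (s.erase z) id := by
  refine ⟨fun z => nodalWeight s id z * r.eval z, ?_⟩
  conv_lhs => rw [eq_interpolate (v := id) Function.injective_id.injOn h,
    interpolate_eq_nodalWeight_mul_nodal_div_X_sub_C]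
  refine Finset.sum_congr rfl fun z hz => ?_
  rw [nodal_erase_eq_nodal_div hz, C_mul, mul_right_comm]
  rfl

-- Multiplying by `N = ∏ (X - z)` turns resolvents into polynomials in `D`, and by Cayley-Hamilton
-- `p N` may be replaced by a polynomial of degree less than the number of nodes.
lemma mem_invariantCore_of_resolvent_mem [FiniteDimensional K V] {σ : Set K}
    (hσ : (Module.finrank K V : ℕ∞) ≤ σ.encard)
    (hinj : ∀ z ∈ σ, Function.Injective fun v => D v - z • v) {y : V}
    (hy : ∀ z ∈ σ, ∃ w ∈ W, D w - z • w = y) : y ∈ invariantCore D W := by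
  classical
  obtain ⟨s, hsσ, hs⟩ := Set.exists_subset_encard_eq hσ
  lift s to Finset K using Set.finite_of_encard_eq_coe hs
  rw [Set.encard_coe_eq_coe_finsetCard, Nat.cast_inj] at hs
  choose! w hwW hwy using fun z hz => hy z (hsσ hz)
  refine mem_invariantCore.2 fun p => ?_
  set N := nodal s id with hN
  set r := (p * N) %ₘ D.charpoly
  have hdeg : r.degree < s.card := by
    refine (degree_modByMonic_lt _ D.charpoly_monic).trans_eq ?_
    rw [degree_eq_natDegree D.charpoly_monic.ne_zero, LinearMap.charpoly_natDegree, hs]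
  have haeval : aeval D r = aeval D (p * N) := by
    simpa [LinearMap.aeval_self_charpoly] using
      congrArg (aeval D) (modByMonic_add_div (p * N) D.charpoly)
  obtain ⟨c, hc⟩ := exists_eq_sum_nodal_erase hdeg
  have hpy : aeval D N (aeval D p y) = aeval D N (∑ z ∈ s, c z • w z) := by
    rw [← Module.End.mul_apply, ← map_mul, mul_comm, ← haeval, hc, map_sum, LinearMap.sum_apply,
      map_sum]
    refine Finset.sum_congr rfl fun z hz => ?_
    rw [hN, nodal_eq_mul_nodal_erase hz, mul_comm (X - _), ← hwy z hz]
    simp [Module.algebraMap_end_apply, smul_sub]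
  rw [aeval_nodal_injective (fun z hz => hinj z (hsσ hz)) hpy]
  exact W.sum_mem fun z hz => W.smul_mem _ (hwW z hz)

end CyclicSubspaces

section PartialFractions

open Polynomial Lagrange

lemma exists_eq_sum_inv_add {Λ : Finset ℝ} (hΛ : ∀ t ∈ Λ, 0 < t) (g : ℝ → ℝ) :
    ∃ c : ℕ → ℝ, ∀ t ∈ Λ, g t = ∑ k ∈ Finset.range Λ.card, c k * ((k + 1 : ℝ) + t)⁻¹ := by
  let v : ℕ → ℝ := fun k => -(k + 1)
  let s := Finset.range Λ.card
  have hv : Set.InjOn v s := fun j _ k _ hjk => by simpa [v] using hjk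
  let P := interpolate Λ id fun t => g t * (nodal s v).eval t
  have hP : P.degree < s.card := by
    simpa only [s, Finset.card_range] using degree_interpolate_lt _ Function.injective_id.injOn
  refine ⟨fun k => nodalWeight s v k * P.eval (v k), fun t ht => ?_⟩
  have htv : ∀ k ∈ s, t ≠ v k := fun k _ => by
    have := hΛ t ht
    simp only [v]
    linarith [(k.cast_nonneg : (0 : ℝ) ≤ k)]
  have hN := eval_nodal_not_at_node htv
  have hPt : P.eval t = g t * (nodal s v).eval t :=
    eval_interpolate_at_node (v := id) _ Function.injective_id.injOn ht
  rw [eq_interpolate hv hP, eval_interpolate_not_at_node _ htv, mul_comm, mul_left_inj' hN] at hPt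
  rw [← hPt]
  refine Finset.sum_congr rfl fun k _ => ?_
  rw [mul_right_comm, add_comm _ t, ← sub_neg_eq_add]

lemma sum_mul_eq_zero_of_sum_mul_inv_add_eq_zero {ι : Type*} [Fintype ι] {u : ι → ℝ}
    (hu : ∀ i, 0 < u i) {μ : ι → ℂ} (h : ∀ s : ℝ, 0 < s → ∑ i, μ i * ((s + u i)⁻¹ : ℝ) = 0)
    (g : ℝ → ℝ) : ∑ i, μ i * g (u i) = 0 := by
  classical
  obtain ⟨c, hc⟩ := exists_eq_sum_inv_add (Λ := Finset.univ.image u) (by simpa using hu) g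
  simp only [fun i => hc (u i) (Finset.mem_image_of_mem u (Finset.mem_univ i)),
    Complex.ofReal_sum, Complex.ofReal_mul, Finset.mul_sum]
  rw [Finset.sum_comm]
  refine Finset.sum_eq_zero fun k _ => ?_
  simp only [mul_left_comm (μ _) (c k : ℂ), ← Finset.mul_sum, h (k + 1) k.cast_add_one_pos,
    mul_zero]

end PartialFractions

section Positivity

open Matrix
open scoped MatrixOrder

variable {ι : Type*} [Fintype ι]

lemma trace_mul_nonneg {P Q : Matrix ι ι ℂ} (hP : P.PosSemidef) (hQ : Q.PosSemidef) :
    0 ≤ (P * Q).trace := by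
  classical
  obtain ⟨C, rfl⟩ := CStarAlgebra.nonneg_iff_eq_star_mul_self.mp hQ.nonneg
  rw [← mul_assoc, trace_mul_comm, ← mul_assoc]
  exact (hP.mul_mul_conjTranspose_same C).trace_nonneg

lemma eq_zero_of_trace_mul_eq_zero {W P : Matrix ι ι ℂ} (hW : W.PosDef) (hP : P.PosSemidef)
    (h : (W * P).trace = 0) : P = 0 := by
  classical
  obtain ⟨C, hC, rfl⟩ :=
    CStarAlgebra.isStrictlyPositive_iff_eq_star_mul_self.mp hW.isStrictlyPositive
  rw [mul_assoc, trace_mul_comm, star_eq_conjTranspose,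
    (hP.mul_mul_conjTranspose_same C).trace_eq_zero_iff] at h
  rw [← hC.mul_right_eq_zero, ← hC.star.mul_left_eq_zero]
  exact h

variable [DecidableEq ι] {C : StarSubalgebra ℂ (Matrix ι ι ℂ)} {W X : Matrix ι ι ℂ}

-- Polarization: test the quadratic form at `X + 1` and at `X + i`.
lemma eq_zero_of_trace_conj_eq_zero (hW : W.PosDef) (hX : X ∈ C)
    (h : ∀ d ∈ C, (W * (dᴴ * X * d)).trace = 0) : X = 0 := by
  have hX1 := h (X + 1) (add_mem hX (one_mem C))
  have hXI := h (X + Complex.I • 1) (add_mem hX (C.smul_mem (one_mem C) _))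
  have h1 := h 1 (one_mem C)
  simp only [conjTranspose_add, conjTranspose_one, conjTranspose_smul, add_mul, mul_add, mul_one,
    one_mul, trace_add, h X hX, smul_mul_assoc, mul_smul_comm, trace_smul, smul_eq_mul,
    RCLike.star_def, Complex.conj_I] at hX1 hXI h1
  have hXX : (W * (Xᴴ * X)).trace = 0 := by
    have : 2 * Complex.I * (W * (Xᴴ * X)).trace = 0 := by
      linear_combination Complex.I * hX1 + hXI - (Complex.I - Complex.I * Complex.I) * h1
    simpa using this
  exact conjTranspose_mul_self_eq_zero.1
    (eq_zero_of_trace_mul_eq_zero hW (posSemidef_conjTranspose_mul_self X) hXX)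

lemma isHermitian_of_trace_conj_nonneg (hW : W.PosDef) (hX : X ∈ C)
    (h : ∀ d ∈ C, 0 ≤ (W * (dᴴ * X * d)).trace) : X.IsHermitian := by
  suffices hskew : Xᴴ - X = 0 from sub_eq_zero.1 hskew
  refine eq_zero_of_trace_conj_eq_zero hW (sub_mem (star_mem hX) hX) fun d hd => ?_
  have hstar : (W * (dᴴ * Xᴴ * d)).trace = star (W * (dᴴ * X * d)).trace := by
    rw [← trace_conjTranspose, conjTranspose_mul, hW.isHermitian.eq, trace_mul_comm]
    simp only [conjTranspose_mul, conjTranspose_conjTranspose, mul_assoc]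
  rw [mul_sub, sub_mul, mul_sub, trace_sub, hstar, (IsSelfAdjoint.of_nonneg (h d hd)).star_eq,
    sub_self]

-- Compressing `X` by its negative part `N` gives `N X N = -N³`, which the hypothesis forces to be
-- nonnegative.
lemma posSemidef_of_trace_conj_nonneg (hW : W.PosDef) (hX : X ∈ C)
    (h : ∀ d ∈ C, 0 ≤ (W * (dᴴ * X * d)).trace) : X.PosSemidef := by
  have hXs : IsSelfAdjoint X := isHermitian_of_trace_conj_nonneg hW hX h
  have : IsClosed (C : Set (Matrix ι ι ℂ)) :=
    Submodule.closed_of_finiteDimensional (Subalgebra.toSubmodule C.toSubalgebra)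
  set N := X⁻ with hN
  have hNC : N ∈ C := cfcₙ_mem _ hX
  have hNpos : N.PosSemidef := (CFC.negPart_nonneg X).posSemidef
  have hNs : Nᴴ = N := hNpos.isHermitian
  have hNXN : Nᴴ * X * N = -(N * Nᴴ * N) := by
    rw [hNs, ← CFC.posPart_sub_negPart X, mul_sub, CFC.negPart_mul_posPart, zero_sub, neg_mul]
  have hcube : (N * Nᴴ * N).PosSemidef := by
    simpa only [hNs] using hNpos.mul_mul_conjTranspose_same N
  have hcube0 : N * Nᴴ * N = 0 := by
    refine eq_zero_of_trace_mul_eq_zero hW hcube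
      (le_antisymm ?_ (trace_mul_nonneg hW.posSemidef hcube))
    simpa only [hNXN, mul_neg, trace_neg, neg_nonneg] using h N hNC
  rw [self_mul_conjTranspose_mul_eq_zero, conjTranspose_mul_self_eq_zero, hN,
    CFC.negPart_eq_zero_iff X] at hcube0
  exact hcube0.posSemidef

end Positivity

section HilbertSchmidt

variable {n m : ℕ} {A : Alg n} {B : Alg m}

/-- The trace of `B(ℂⁿ)` as a linear functional on `A`. -/
noncomputable def tr : A →ₗ[ℂ] ℂ where
  toFun a := (a : Op n).trace
  map_add' a b := Matrix.trace_add (a : Op n) b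
  map_smul' c a := Matrix.trace_smul c (a : Op n)

lemma tr_mul_comm (a b : A) : tr (a * b) = tr (b * a) :=
  Matrix.trace_mul_comm (a : Op n) (b : Op n)

lemma tr_star (a : A) : tr (star a) = star (tr a) :=
  Matrix.trace_conjTranspose (a : Op n)

lemma tr_mul_nonneg {a b : A} (ha : (a : Op n).PosSemidef) (hb : (b : Op n).PosSemidef) :
    0 ≤ tr (a * b) := trace_mul_nonneg ha hb

lemma eq_zero_of_tr_mul_eq_zero {ρ a : A} (hρ : (ρ : Op n).PosDef) (ha : (a : Op n).PosSemidef)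
    (h : tr (ρ * a) = 0) : a = 0 :=
  Subtype.ext (eq_zero_of_trace_mul_eq_zero hρ ha h)

lemma posSemidef_star_mul_self (a : A) : ((star a * a : A) : Op n).PosSemidef :=
  Matrix.posSemidef_conjTranspose_mul_self _

lemma posSemidef_mul_star_self (a : A) : ((a * star a : A) : Op n).PosSemidef :=
  Matrix.posSemidef_self_mul_conjTranspose _

lemma star_eq_of_posSemidef {a : A} (ha : (a : Op n).PosSemidef) : star a = a :=
  Subtype.ext ha.isHermitian

lemma posDef_of_isUnit {ρ : A} (h : (ρ : Op n).PosSemidef) (hu : IsUnit ρ) : (ρ : Op n).PosDef :=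
  h.posDef_iff_isUnit.2 (hu.map A.subtype)

lemma hs_eq_tr (a b : A) : hs a b = tr (star a * b) := rfl

lemma star_hs (a b : A) : star (hs a b) = hs b a := by
  rw [hs_eq_tr, hs_eq_tr, ← tr_star, star_mul, star_star]

lemma hs_star_right (a b : A) : hs a (star b) = hs b (star a) := tr_mul_comm _ _

lemma hs_sub_right (a b c : A) : hs a (b - c) = hs a b - hs a c := by
  simp only [hs_eq_tr, mul_sub, map_sub]

lemma hs_sub_left (a b c : A) : hs (a - b) c = hs a c - hs b c := by
  simp only [hs_eq_tr, star_sub, sub_mul, map_sub]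

lemma hs_right_injective {a b : A} (h : ∀ x, hs x a = hs x b) : a = b :=
  hs_left_injective fun x => by rw [← star_hs x a, ← star_hs x b, h]

lemma hs_hsAdjoint_right (T : A →ₗ[ℂ] B) (b : B) (a : A) : hs a (hsAdjoint T b) = hs (T a) b := by
  rw [← star_hs, hs_hsAdjoint, star_hs]

lemma hsAdjoint_hsAdjoint (T : A →ₗ[ℂ] B) : hsAdjoint (hsAdjoint T) = T :=
  LinearMap.ext fun a => hs_left_injective fun b => by rw [hs_hsAdjoint, hs_hsAdjoint_right]

variable {T : A →ₗ[ℂ] B}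

lemma map_star_of_hsAdjoint (h : ∀ b, hsAdjoint T (star b) = star (hsAdjoint T b)) (a : A) :
    T (star a) = star (T a) :=
  hs_right_injective fun b => by
    rw [← hs_hsAdjoint, hs_star_right, ← h, hs_hsAdjoint_right, hs_star_right]

lemma tr_map_of_hsAdjoint (h : hsAdjoint T 1 = 1) (a : A) : tr (T a) = tr a := by
  simpa only [h, hs_eq_tr, star_one, one_mul] using (hs_hsAdjoint T 1 a).symm

lemma posSemidef_map_of_hsAdjoint
    (h : ∀ b, ((hsAdjoint T (star b * b) : A) : Op n).PosSemidef) {a : A}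
    (ha : (a : Op n).PosSemidef) : (T a : Op m).PosSemidef := by
  refine posSemidef_of_trace_conj_nonneg Matrix.PosDef.one (T a).2 fun d hd => ?_
  let e : B := ⟨d, hd⟩
  have he := hs_hsAdjoint T (star (star e) * star e) a
  rw [hs_eq_tr, hs_eq_tr, star_eq_of_posSemidef (h (star e)), star_star] at he
  rw [one_mul, Matrix.trace_mul_comm, ← mul_assoc]
  have hpos := tr_mul_nonneg (h (star e)) ha
  rwa [star_star, he, star_mul, star_star] at hpos

lemma isUnit_of_posDef {ρ : A} (h : (ρ : Op n).PosDef) : IsUnit ρ := by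
  open scoped Matrix.Norms.L2Operator in
  have : IsClosed (A : Set (Op n)) := isClosed_alg A
  exact (StarSubalgebra.coe_isUnit (hS := this)).1 h.isUnit

end HilbertSchmidt

section QuadraticForm

variable {n : ℕ} {A : Alg n}

/-- The operator `s R_ρ + L_ρ`, which is `J_ρ` for the function `t ↦ s + t`. -/
noncomputable def mulSum {C : Type*} [Ring C] [Algebra ℂ C] (s : ℝ) (ρ : C) : Module.End ℂ C :=
  (s : ℂ) • LinearMap.mulRight ℂ ρ + LinearMap.mulLeft ℂ ρ

lemma mulSum_apply {C : Type*} [Ring C] [Algebra ℂ C] (s : ℝ) (ρ b : C) :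
    mulSum s ρ b = (s : ℂ) • (b * ρ) + ρ * b := rfl

lemma hs_mulSum_self (s : ℝ) (ρ b : A) :
    hs b (mulSum s ρ b) = s * tr (ρ * (star b * b)) + tr (ρ * (b * star b)) := by
  rw [hs_eq_tr, mulSum_apply, mul_add, mul_smul_comm, map_add, map_smul, smul_eq_mul,
    tr_mul_comm ρ (star b * b), mul_assoc, tr_mul_comm (star b) (ρ * b), mul_assoc]

lemma hs_mulSum_left (s : ℝ) {ρ : A} (hρ : star ρ = ρ) (a b : A) :
    hs (mulSum s ρ a) b = hs a (mulSum s ρ b) := by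
  simp only [hs_eq_tr, mulSum_apply, star_add, star_smul, star_mul, hρ, add_mul, mul_add,
    mul_smul_comm, smul_mul_assoc, map_add, map_smul, RCLike.star_def, Complex.conj_ofReal]
  rw [← mul_assoc (star a) b ρ, tr_mul_comm (star a * b) ρ, mul_assoc, mul_assoc]

variable {s : ℝ} {ρ : A}

lemma smul_tr_add_tr_nonneg (hs₀ : 0 ≤ s) (hρ : (ρ : Op n).PosSemidef) {p q : A}
    (hp : (p : Op n).PosSemidef) (hq : (q : Op n).PosSemidef) :
    0 ≤ s * tr (ρ * p) + tr (ρ * q) :=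
  add_nonneg (mul_nonneg (by exact_mod_cast hs₀) (tr_mul_nonneg hρ hp)) (tr_mul_nonneg hρ hq)

lemma eq_zero_of_smul_tr_add_tr_eq_zero (hs₀ : 0 ≤ s) (hρ : (ρ : Op n).PosDef) {p q : A}
    (hp : (p : Op n).PosSemidef) (hq : (q : Op n).PosSemidef)
    (h : s * tr (ρ * p) + tr (ρ * q) = 0) : (s = 0 ∨ p = 0) ∧ q = 0 := by
  obtain ⟨hsp, hq0⟩ := (add_eq_zero_iff_of_nonneg
    (mul_nonneg (by exact_mod_cast hs₀) (tr_mul_nonneg hρ.posSemidef hp))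
    (tr_mul_nonneg hρ.posSemidef hq)).1 h
  exact ⟨(mul_eq_zero.1 hsp).imp Complex.ofReal_eq_zero.1 (eq_zero_of_tr_mul_eq_zero hρ hp),
    eq_zero_of_tr_mul_eq_zero hρ hq hq0⟩

lemma hs_mulSum_self_nonneg (hs₀ : 0 ≤ s) (hρ : (ρ : Op n).PosSemidef) (b : A) :
    0 ≤ hs b (mulSum s ρ b) := by
  rw [hs_mulSum_self]
  exact smul_tr_add_tr_nonneg hs₀ hρ (posSemidef_star_mul_self b) (posSemidef_mul_star_self b)

lemma eq_zero_of_hs_mulSum_self_eq_zero (hs₀ : 0 ≤ s) (hρ : (ρ : Op n).PosDef) {b : A}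
    (h : hs b (mulSum s ρ b) = 0) : b = 0 := by
  rw [hs_mulSum_self] at h
  exact Subtype.ext (Matrix.self_mul_conjTranspose_eq_zero.1 (congrArg Subtype.val
    (eq_zero_of_smul_tr_add_tr_eq_zero hs₀ hρ (posSemidef_star_mul_self b)
      (posSemidef_mul_star_self b) h).2))

lemma mulSum_injective (hs₀ : 0 ≤ s) (hρ : (ρ : Op n).PosDef) : Function.Injective (mulSum s ρ) :=
  (injective_iff_map_eq_zero _).2 fun b hb => eq_zero_of_hs_mulSum_self_eq_zero hs₀ hρ <| by
    rw [hb, hs_eq_tr, mul_zero, map_zero]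

lemma isUnit_mulSum (hs₀ : 0 ≤ s) (hρ : (ρ : Op n).PosDef) : IsUnit (mulSum s ρ) :=
  (LinearMap.isUnit_iff_ker_eq_bot _).2 (LinearMap.ker_eq_bot.2 (mulSum_injective hs₀ hρ))

/-- The inverse of `s R_ρ + L_ρ`, for `s ≥ 0` and positive definite `ρ`. -/
noncomputable def mulSumInv (s : ℝ) (ρ : A) : Module.End ℂ A := Ring.inverse (mulSum s ρ)

lemma mulSum_mulSumInv (hs₀ : 0 ≤ s) (hρ : (ρ : Op n).PosDef) (x : A) :
    mulSum s ρ (mulSumInv s ρ x) = x :=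
  LinearMap.congr_fun (Ring.mul_inverse_cancel _ (isUnit_mulSum hs₀ hρ)) x

lemma hs_mulSumInv_left (hs₀ : 0 ≤ s) (hρ : (ρ : Op n).PosDef) (x y : A) :
    hs (mulSumInv s ρ x) y = hs x (mulSumInv s ρ y) := by
  conv_lhs => rw [← mulSum_mulSumInv hs₀ hρ y]
  rw [← hs_mulSum_left s (star_eq_of_posSemidef hρ.posSemidef), mulSum_mulSumInv hs₀ hρ]

/-- The quadratic form of the operator `(s R_ρ + L_ρ)⁻¹`. -/
noncomputable def invForm (s : ℝ) (ρ x : A) : ℂ := hs (mulSumInv s ρ x) x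

lemma invForm_eq_hs_mulSum (hs₀ : 0 ≤ s) (hρ : (ρ : Op n).PosDef) (x : A) :
    invForm s ρ x = hs (mulSumInv s ρ x) (mulSum s ρ (mulSumInv s ρ x)) := by
  rw [invForm, mulSum_mulSumInv hs₀ hρ]

end QuadraticForm

section Schwarz

lemma eq_zero_of_forall_nonneg {α ξ : ℂ} (h : ∀ z : ℂ, 0 ≤ α + z * ξ + star z * star ξ) :
    ξ = 0 := by
  by_contra hξ
  obtain ⟨k, hk⟩ : ∃ k : ℝ, k * Complex.normSq ξ = α.re + 1 :=
    ⟨_, div_mul_cancel₀ _ (Complex.normSq_pos.2 hξ).ne'⟩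
  have hre : ((α + -(k : ℂ) * star ξ * ξ + star (-(k : ℂ) * star ξ) * star ξ)).re =
      α.re - 2 * (k * Complex.normSq ξ) := by
    simp [Complex.normSq_apply]
    ring
  have hα : 0 ≤ α.re := by simpa using (Complex.nonneg_iff.1 (h 0)).1
  have hk_nonneg := (Complex.nonneg_iff.1 (h (-(k : ℂ) * star ξ))).1
  rw [hre, hk] at hk_nonneg
  linarith

variable {n m : ℕ} {A : Alg n} {B : Alg m} {Φ : A →ₗ[ℂ] B}

lemma map_star_of_map_isSelfAdjoint (h : ∀ a, IsSelfAdjoint a → IsSelfAdjoint (Φ a)) (a : A) :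
    Φ (star a) = star (Φ a) := by
  have hre := h _ (realPart a).2
  have him := h _ (imaginaryPart a).2
  rw [← realPart_add_I_smul_imaginaryPart a]
  simp only [star_add, star_smul, map_add, map_smul, hre.star_eq, him.star_eq,
    (realPart a).2.star_eq, (imaginaryPart a).2.star_eq]

lemma IsUnitalSchwarz.posSemidef_map (h : IsUnitalSchwarz Φ) (a : A) :
    (Φ (star a * a) : Op m).PosSemidef := by
  have := (h.2 a).add (posSemidef_star_mul_self (Φ a))
  rwa [← AddMemClass.coe_add, sub_add_cancel] at this

lemma IsUnitalSchwarz.map_star (h : IsUnitalSchwarz Φ) (a : A) : Φ (star a) = star (Φ a) := by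
  refine map_star_of_map_isSelfAdjoint (fun x hx => ?_) a
  have hsq (y : A) : IsSelfAdjoint (Φ (star y * y)) := star_eq_of_posSemidef (h.posSemidef_map y)
  have htwo : (2 : ℂ) • Φ x = Φ (star (x + 1) * (x + 1)) - Φ (star x * x) - 1 := by
    rw [← h.1, ← map_smul, ← map_sub, ← map_sub, star_add, hx.star_eq, star_one, two_smul]
    congr 1
    noncomm_ring
  have : IsSelfAdjoint ((2 : ℂ) • Φ x) := htwo ▸ ((hsq _).sub (hsq _)).sub (.one B)
  rw [← inv_smul_smul₀ (two_ne_zero' ℂ) (Φ x)]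
  exact IsSelfAdjoint.smul (by simp [isSelfAdjoint_iff]) this

/-- The sesquilinear form `Φ (x⋆ y) - (Φ x)⋆ Φ y`, which vanishes for multiplicative `Φ` and is
positive for Schwarz maps. -/
def schwarzDefect (Φ : A →ₗ[ℂ] B) (x y : A) : B := Φ (star x * y) - star (Φ x) * Φ y

lemma schwarzDefect_add_smul_self (Φ : A →ₗ[ℂ] B) (x y : A) (z : ℂ) :
    schwarzDefect Φ (x + z • y) (x + z • y) =
      schwarzDefect Φ x x + z • schwarzDefect Φ x y + star z • schwarzDefect Φ y x +
        (star z * z) • schwarzDefect Φ y y := by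
  simp only [schwarzDefect, star_add, star_smul, map_add, map_smul, add_mul, mul_add,
    smul_mul_assoc, mul_smul_comm, smul_smul, smul_sub, smul_add, mul_comm (star z) z]
  abel

lemma star_schwarzDefect (h : ∀ a, Φ (star a) = star (Φ a)) (x y : A) :
    star (schwarzDefect Φ x y) = schwarzDefect Φ y x := by
  simp only [schwarzDefect, star_sub, ← h, star_mul, star_star]

lemma IsUnitalSchwarz.posSemidef_schwarzDefect (h : IsUnitalSchwarz Φ) (b : A) :
    (schwarzDefect Φ b b : Op m).PosSemidef := h.2 b

lemma IsUnitalSchwarz.schwarzDefect_eq_zero (h : IsUnitalSchwarz Φ) {b : A}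
    (hb : schwarzDefect Φ b b = 0) (c : A) : schwarzDefect Φ c b = 0 := by
  refine Subtype.ext (eq_zero_of_trace_conj_eq_zero Matrix.PosDef.one (schwarzDefect Φ c b).2
    fun d hd => ?_)
  let φ (x : B) : ℂ := tr (star ⟨d, hd⟩ * x * ⟨d, hd⟩)
  have hφ (x y z : B) (ζ : ℂ) : φ (x + ζ • y + star ζ • star z) =
      φ x + ζ * φ y + star ζ * star (φ z) := by
    simp only [φ, ← tr_star, star_mul, star_star, mul_add, add_mul, mul_smul_comm, smul_mul_assoc,
      map_add, map_smul, smul_eq_mul, mul_assoc]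
  have hφ_nonneg {x : B} (hx : (x : Op m).PosSemidef) : 0 ≤ φ x :=
    (hx.conjTranspose_mul_mul_same d).trace_nonneg
  have hφ_zero : φ (schwarzDefect Φ c b) = 0 := by
    refine eq_zero_of_forall_nonneg (α := φ (schwarzDefect Φ c c)) fun ζ => ?_
    have hpos := h.posSemidef_schwarzDefect (c + ζ • b)
    rw [schwarzDefect_add_smul_self, hb, smul_zero, add_zero, ← star_schwarzDefect h.map_star c b]
      at hpos
    rw [← hφ]
    exact hφ_nonneg hpos
  rw [one_mul]
  exact hφ_zero

/-- The graph of `Φ` over its multiplicative domain. -/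
def multiplicativeGraph (Φ : A →ₗ[ℂ] B) (hΦ : ∀ a, Φ (star a) = star (Φ a)) :
    StarSubalgebra ℂ (A × B) where
  carrier := {p | (∀ c, Φ (c * p.1) = Φ c * p.2) ∧ ∀ c, Φ (p.1 * c) = p.2 * Φ c}
  mul_mem' {p q} hp hq :=
    ⟨fun c => by rw [Prod.fst_mul, Prod.snd_mul, ← mul_assoc, hq.1, hp.1, mul_assoc],
      fun c => by rw [Prod.fst_mul, Prod.snd_mul, mul_assoc, hp.2, hq.2, mul_assoc]⟩
  add_mem' {p q} hp hq :=
    ⟨fun c => by rw [Prod.fst_add, Prod.snd_add, mul_add, map_add, hp.1, hq.1, mul_add],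
      fun c => by rw [Prod.fst_add, Prod.snd_add, add_mul, map_add, hp.2, hq.2, add_mul]⟩
  algebraMap_mem' z := by
    simp only [Set.mem_ofPred_eq, Algebra.algebraMap_eq_smul_one, Prod.smul_fst, Prod.smul_snd,
      Prod.fst_one, Prod.snd_one, mul_smul_comm, smul_mul_assoc, mul_one, one_mul, map_smul,
      implies_true, and_self]
  star_mem' {p} hp := by
    constructor <;> intro c
    · simpa [← hΦ] using congrArg star (hp.2 (star c))
    · simpa [← hΦ] using congrArg star (hp.1 (star c))

lemma mem_multiplicativeGraph {hΦ : ∀ a, Φ (star a) = star (Φ a)} {p : A × B} :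
    p ∈ multiplicativeGraph Φ hΦ ↔
      (∀ c, Φ (c * p.1) = Φ c * p.2) ∧ ∀ c, Φ (p.1 * c) = p.2 * Φ c := Iff.rfl

lemma map_fst_of_mem_multiplicativeGraph {hΦ : ∀ a, Φ (star a) = star (Φ a)} (h₁ : Φ 1 = 1)
    {p : A × B} (hp : p ∈ multiplicativeGraph Φ hΦ) : Φ p.1 = p.2 := by
  rw [← one_mul p.1, hp.1, h₁, one_mul]

lemma IsUnitalSchwarz.mem_multiplicativeGraph (h : IsUnitalSchwarz Φ) {b : A}
    (hb : schwarzDefect Φ b b = 0) (hb' : schwarzDefect Φ (star b) (star b) = 0) :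
    (b, Φ b) ∈ multiplicativeGraph Φ h.map_star := by
  refine QuantumReversibility.mem_multiplicativeGraph.2 ⟨fun c => ?_, fun c => ?_⟩
  · have := sub_eq_zero.1 (h.schwarzDefect_eq_zero hb (star c))
    rwa [star_star, h.map_star, star_star] at this
  · have := congrArg star (sub_eq_zero.1 (h.schwarzDefect_eq_zero hb' c))
    simpa only [star_mul, star_star, ← h.map_star] using this

end Schwarz

section Monotonicity

variable {n m : ℕ} {A : Alg n} {B : Alg m} {T : A →ₗ[ℂ] B} {s : ℝ} {ρ : A}

lemma tr_mul_hsAdjoint (h : ∀ b, hsAdjoint T (star b) = star (hsAdjoint T b)) (a : A) (b : B) :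
    tr (a * hsAdjoint T b) = tr (T a * b) := by
  rw [← star_star a, map_star_of_hsAdjoint h]
  exact hs_hsAdjoint_right T b (star a)

lemma invForm_sub_invForm_map (hT : IsUnitalSchwarz (hsAdjoint T)) (hs₀ : 0 ≤ s)
    (hρ : (ρ : Op n).PosDef) (hτ : (T ρ : Op m).PosDef) (x : A) {a : A} {b : B}
    (ha : mulSumInv s ρ x = a) (hb : mulSumInv s (T ρ) (T x) = b) :
    invForm s ρ x - invForm s (T ρ) (T x) =
      hs (a - hsAdjoint T b) (mulSum s ρ (a - hsAdjoint T b)) +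
        (s * tr (ρ * schwarzDefect (hsAdjoint T) b b) +
          tr (ρ * schwarzDefect (hsAdjoint T) (star b) (star b))) := by
  have hform : invForm s (T ρ) (T x) =
      s * tr (T ρ * (star b * b)) + tr (T ρ * (b * star b)) := by
    rw [invForm_eq_hs_mulSum hs₀ hτ, hb, hs_mulSum_self]
  have hleft : hs (hsAdjoint T b) x = invForm s (T ρ) (T x) := by
    rw [hs_hsAdjoint, invForm, hb]
  have hright : hs a (mulSum s ρ (hsAdjoint T b)) = invForm s (T ρ) (T x) := by
    rw [← hs_mulSum_left s (star_eq_of_posSemidef hρ.posSemidef), ← ha, mulSum_mulSumInv hs₀ hρ,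
      hs_hsAdjoint_right, invForm, hs_mulSumInv_left hs₀ hτ, hb]
  have hax : mulSum s ρ a = x := by rw [← ha, mulSum_mulSumInv hs₀ hρ]
  have hx : invForm s ρ x = hs a x := by rw [invForm, ha]
  simp only [schwarzDefect, mul_sub, map_sub, hs_sub_left, hs_sub_right, hright, hleft, hax, hx,
    tr_mul_hsAdjoint hT.map_star, hs_mulSum_self, hT.map_star, star_star]
  rw [hform]
  ring

lemma invForm_map_le (hT : IsUnitalSchwarz (hsAdjoint T)) (hs₀ : 0 ≤ s) (hρ : (ρ : Op n).PosDef)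
    (hτ : (T ρ : Op m).PosDef) (x : A) : invForm s (T ρ) (T x) ≤ invForm s ρ x := by
  rw [← sub_nonneg, invForm_sub_invForm_map hT hs₀ hρ hτ x rfl rfl]
  exact add_nonneg (hs_mulSum_self_nonneg hs₀ hρ.posSemidef _)
    (smul_tr_add_tr_nonneg hs₀ hρ.posSemidef (hT.posSemidef_schwarzDefect _)
      (hT.posSemidef_schwarzDefect _))

lemma eq_and_schwarzDefect_eq_zero_of_invForm_map_eq (hT : IsUnitalSchwarz (hsAdjoint T))
    (hs₀ : 0 ≤ s) (hρ : (ρ : Op n).PosDef) (hτ : (T ρ : Op m).PosDef) {x a : A} {b : B}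
    (ha : mulSumInv s ρ x = a) (hb : mulSumInv s (T ρ) (T x) = b)
    (h : invForm s (T ρ) (T x) = invForm s ρ x) :
    hsAdjoint T b = a ∧ (s = 0 ∨ schwarzDefect (hsAdjoint T) b b = 0) ∧
      schwarzDefect (hsAdjoint T) (star b) (star b) = 0 := by
  have hgap := invForm_sub_invForm_map hT hs₀ hρ hτ x ha hb
  rw [h, sub_self, eq_comm, add_eq_zero_iff_of_nonneg (hs_mulSum_self_nonneg hs₀ hρ.posSemidef _)
    (smul_tr_add_tr_nonneg hs₀ hρ.posSemidef (hT.posSemidef_schwarzDefect _)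
      (hT.posSemidef_schwarzDefect _))] at hgap
  exact ⟨(sub_eq_zero.1 (eq_zero_of_hs_mulSum_self_eq_zero hs₀ hρ hgap.1)).symm,
    eq_zero_of_smul_tr_add_tr_eq_zero hs₀ hρ (hT.posSemidef_schwarzDefect _)
      (hT.posSemidef_schwarzDefect _) hgap.2⟩

lemma invForm_map_eq_of_hsAdjoint_mulSumInv_eq {x : A}
    (h : hsAdjoint T (mulSumInv s (T ρ) (T x)) = mulSumInv s ρ x) :
    invForm s (T ρ) (T x) = invForm s ρ x := by
  rw [invForm, invForm, ← h, hs_hsAdjoint]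

lemma mulSumInv_mem_multiplicativeGraph (hT : IsUnitalSchwarz (hsAdjoint T)) (hs₀ : 0 < s)
    (hρ : (ρ : Op n).PosDef) (hτ : (T ρ : Op m).PosDef) {x : A}
    (h : invForm s (T ρ) (T x) = invForm s ρ x) :
    (mulSumInv s (T ρ) (T x), mulSumInv s ρ x) ∈
      multiplicativeGraph (hsAdjoint T) hT.map_star := by
  obtain ⟨hmap, hdefect, hdefect'⟩ :=
    eq_and_schwarzDefect_eq_zero_of_invForm_map_eq hT hs₀.le hρ hτ rfl rfl h
  rw [← hmap]
  exact hT.mem_multiplicativeGraph (hdefect.resolve_left hs₀.ne') hdefect'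

end Monotonicity

section Conjugation

open ConjAct Polynomial

lemma star_toConjAct_smul {C : Type*} [Ring C] [StarRing C] {u : Cˣ} (hu : star u = u) (v : C) :
    star (toConjAct u • v) = toConjAct u⁻¹ • star v := by
  rw [units_smul_def, units_smul_def, ofConjAct_toConjAct, ofConjAct_toConjAct, star_mul, star_mul,
    ← Units.coe_star, ← Units.coe_star, star_inv, hu, inv_inv, mul_assoc]

variable {C : Type*} [Ring C] [Algebra ℂ C]

/-- Conjugation `v ↦ u v u⁻¹` by a unit, which is the modular operator if `u` is a density. -/
def conjOp (u : Cˣ) : Module.End ℂ C := DistribSMul.toLinearMap ℂ C (toConjAct u)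

lemma conjOp_apply (u : Cˣ) (v : C) : conjOp u v = toConjAct u • v := rfl

lemma conjOp_sub_neg_smul (u : Cˣ) (s : ℝ) (v : C) :
    conjOp u v - (-s : ℂ) • v = mulSum s (u : C) v * ↑u⁻¹ := by
  rw [conjOp_apply, units_smul_def, ofConjAct_toConjAct, mulSum_apply, add_mul, smul_mul_assoc,
    Units.mul_inv_cancel_right, neg_smul, sub_neg_eq_add, add_comm]

lemma conjOp_mem_invariantCore_iff [FiniteDimensional ℂ C] {u : Cˣ} {W : Submodule ℂ C} {v : C} :
    toConjAct u • v ∈ invariantCore (conjOp u) W ↔ v ∈ invariantCore (conjOp u) W := by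
  have hX (v : C) : aeval (conjOp u) (X : ℂ[X]) v = toConjAct u • v := by rw [aeval_X, conjOp_apply]
  rw [← hX]
  exact ⟨mem_invariantCore_of_aeval_mem fun v w h => smul_left_cancel _ (by rwa [← hX, ← hX]),
    aeval_mem_invariantCore X⟩

lemma zpow_smul_mem_invariantCore [FiniteDimensional ℂ C] {u : Cˣ} {W : Submodule ℂ C} {v : C}
    (hv : v ∈ invariantCore (conjOp u) W) (k : ℤ) :
    toConjAct (u ^ k) • v ∈ invariantCore (conjOp u) W := by
  induction k with
  | zero => simpa using hv
  | succ k ih =>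
    rwa [add_comm, zpow_add, map_mul, mul_smul, zpow_one, conjOp_mem_invariantCore_iff]
  | pred k ih =>
    rwa [← conjOp_mem_invariantCore_iff, ← mul_smul, ← map_mul, ← zpow_one_add, add_sub_cancel]

variable [StarRing C] [StarModule ℂ C]

/-- The largest star subalgebra of `M` that is invariant under conjugation by the self-adjoint unit
`u`. -/
def conjCore (M : StarSubalgebra ℂ C) (u : Cˣ) (hu : star u = u) : StarSubalgebra ℂ C where
  carrier := {v | ∀ k : ℤ, toConjAct (u ^ k) • v ∈ M}
  mul_mem' hv hw k := by
    rw [smul_mul']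
    exact mul_mem (hv k) (hw k)
  add_mem' hv hw k := by
    rw [smul_add]
    exact add_mem (hv k) (hw k)
  algebraMap_mem' z k := by
    rw [Algebra.algebraMap_eq_smul_one, smul_comm, smul_one]
    exact M.smul_mem (one_mem M) z
  star_mem' {v} hv k := by
    have := star_mem (hv (-k))
    rwa [star_toConjAct_smul (by rw [star_zpow, hu]), zpow_neg, inv_inv] at this

variable {M : StarSubalgebra ℂ C} {u : Cˣ} {hu : star u = u}

lemma mem_conjCore {v : C} : v ∈ conjCore M u hu ↔ ∀ k : ℤ, toConjAct (u ^ k) • v ∈ M := Iff.rfl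

lemma conjCore_le : conjCore M u hu ≤ M := fun v hv => by
  simpa using mem_conjCore.1 hv 0

lemma inv_smul_mem_conjCore {v : C} (hv : v ∈ conjCore M u hu) :
    toConjAct u⁻¹ • v ∈ conjCore M u hu := fun k => by
  rw [← mul_smul, ← map_mul, ← zpow_sub_one]
  exact hv _

end Conjugation

section Pairs

variable {n m : ℕ} {A : Alg n} {B : Alg m}

/-- The pair `(τ, ρ)` as a unit of the algebra of pairs. -/
def unitPair (τ : Bˣ) (ρ : Aˣ) : (B × A)ˣ := MulEquiv.prodUnits.symm (τ, ρ)

lemma star_unitPair {τ : Bˣ} {ρ : Aˣ} (hτ : ((τ : B) : Op m).PosSemidef)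
    (hρ : ((ρ : A) : Op n).PosSemidef) : star (unitPair τ ρ) = unitPair τ ρ :=
  Units.ext (Prod.ext (star_eq_of_posSemidef hτ) (star_eq_of_posSemidef hρ))

lemma conjOp_unitPair_sub_neg_smul (τ : Bˣ) (ρ : Aˣ) (s : ℝ) (v : B × A) :
    conjOp (unitPair τ ρ) v - (-s : ℂ) • v =
      (mulSum s (τ : B) v.1 * ↑τ⁻¹, mulSum s (ρ : A) v.2 * ↑ρ⁻¹) :=
  conjOp_sub_neg_smul (unitPair τ ρ) s v

variable {τ : Bˣ} {ρ : Aˣ} {W : Submodule ℂ (B × A)} {y : B} {x : A} {s : ℝ}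

lemma conjOp_unitPair_sub_neg_smul_injective (hτ : ((τ : B) : Op m).PosDef)
    (hρ : ((ρ : A) : Op n).PosDef) (hs₀ : 0 ≤ s) :
    Function.Injective fun v => conjOp (unitPair τ ρ) v - (-s : ℂ) • v := by
  intro v w hvw
  simp only [conjOp_unitPair_sub_neg_smul, Prod.mk.injEq, Units.mul_left_inj] at hvw
  exact Prod.ext (mulSum_injective hs₀ hτ hvw.1) (mulSum_injective hs₀ hρ hvw.2)

lemma conjOp_unitPair_mulSumInv (hτ : ((τ : B) : Op m).PosDef)
    (hρ : ((ρ : A) : Op n).PosDef) (hs₀ : 0 ≤ s) :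
    conjOp (unitPair τ ρ) (mulSumInv s τ y, mulSumInv s ρ x) -
      (-s : ℂ) • (mulSumInv s (τ : B) y, mulSumInv s (ρ : A) x) = (y * ↑τ⁻¹, x * ↑ρ⁻¹) := by
  rw [conjOp_unitPair_sub_neg_smul, mulSum_mulSumInv hs₀ hτ, mulSum_mulSumInv hs₀ hρ]

lemma mul_inv_mem_invariantCore (hτ : ((τ : B) : Op m).PosDef)
    (hρ : ((ρ : A) : Op n).PosDef) {σ : Set ℝ}
    (hσ : (Module.finrank ℂ (B × A) : ℕ∞) ≤ σ.encard)
    (hσ₀ : ∀ s ∈ σ, 0 ≤ s) (h : ∀ s ∈ σ, (mulSumInv s (τ : B) y, mulSumInv s (ρ : A) x) ∈ W) :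
    (y * ↑τ⁻¹, x * ↑ρ⁻¹) ∈ invariantCore (conjOp (unitPair τ ρ)) W := by
  refine mem_invariantCore_of_resolvent_mem (σ := (fun s : ℝ => (-s : ℂ)) '' σ) ?_ ?_ ?_
  · rwa [Function.Injective.encard_image fun s t hst => by simpa using hst]
  · rintro _ ⟨s, hs, rfl⟩
    exact conjOp_unitPair_sub_neg_smul_injective hτ hρ (hσ₀ s hs)
  · rintro _ ⟨s, hs, rfl⟩
    exact ⟨_, h s hs, conjOp_unitPair_mulSumInv hτ hρ (hσ₀ s hs)⟩

open Polynomial in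
lemma mulSumInv_mem_invariantCore (hτ : ((τ : B) : Op m).PosDef)
    (hρ : ((ρ : A) : Op n).PosDef) (hs₀ : 0 ≤ s)
    (h : (y * ↑τ⁻¹, x * ↑ρ⁻¹) ∈ invariantCore (conjOp (unitPair τ ρ)) W) :
    (mulSumInv s (τ : B) y, mulSumInv s (ρ : A) x) ∈ invariantCore (conjOp (unitPair τ ρ)) W := by
  have hq (v : B × A) : aeval (conjOp (unitPair τ ρ)) (X - C (-s : ℂ)) v =
      conjOp (unitPair τ ρ) v - (-s : ℂ) • v := by
    rw [map_sub, aeval_X, aeval_C, LinearMap.sub_apply, Module.algebraMap_end_apply]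
  refine mem_invariantCore_of_aeval_mem (q := X - C (-s : ℂ)) (fun v w hvw => ?_) ?_
  · rw [hq, hq] at hvw
    exact conjOp_unitPair_sub_neg_smul_injective hτ hρ hs₀ hvw
  · rwa [hq, conjOp_unitPair_mulSumInv hτ hρ hs₀]

end Pairs

section Rigidity

variable {n m : ℕ} {A : Alg n} {B : Alg m} {T : A →ₗ[ℂ] B}

lemma invForm_map_eq_of_finrank_le_encard (hT : IsUnitalSchwarz (hsAdjoint T)) {ρ x : A}
    (hρ : (ρ : Op n).PosDef) (hτ : (T ρ : Op m).PosDef) {σ : Set ℝ}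
    (hσ : (Module.finrank ℂ (B × A) : ℕ∞) ≤ σ.encard) (hσ₀ : ∀ s ∈ σ, 0 ≤ s)
    (h : ∀ s ∈ σ, invForm s (T ρ) (T x) = invForm s ρ x) {s : ℝ} (hs₀ : 0 ≤ s) :
    invForm s (T ρ) (T x) = invForm s ρ x := by
  obtain ⟨ρ', hρ'⟩ := isUnit_of_posDef hρ
  obtain ⟨τ', hτ'⟩ := isUnit_of_posDef hτ
  have hτ'pos : ((τ' : B) : Op m).PosDef := hτ' ▸ hτ
  have hρ'pos : ((ρ' : A) : Op n).PosDef := hρ' ▸ hρ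
  have hgraph : ∀ s ∈ σ, (mulSumInv s (τ' : B) (T x), mulSumInv s (ρ' : A) x) ∈
      (hsAdjoint T).graph := fun s hs => by
    rw [hτ', hρ', LinearMap.mem_graph_iff]
    exact (eq_and_schwarzDefect_eq_zero_of_invForm_map_eq hT (hσ₀ s hs) hρ hτ rfl rfl
      (h s hs)).1.symm
  have hmem := invariantCore_le <| mulSumInv_mem_invariantCore hτ'pos hρ'pos hs₀ <|
    mul_inv_mem_invariantCore hτ'pos hρ'pos hσ hσ₀ hgraph
  rw [hτ', hρ', LinearMap.mem_graph_iff] at hmem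
  exact invForm_map_eq_of_hsAdjoint_mulSumInv_eq hmem.symm

lemma mul_inv_mem_conjCore (hT : IsUnitalSchwarz (hsAdjoint T)) {ρ : Aˣ} {τ : Bˣ} {x : A}
    (hTρ : T ρ = τ) (hρ : ((ρ : A) : Op n).PosDef) (hτ : ((τ : B) : Op m).PosDef)
    (h : ∀ s : ℝ, 0 < s → invForm s (τ : B) (T x) = invForm s (ρ : A) x) :
    (T x * ↑τ⁻¹, x * ↑ρ⁻¹) ∈ conjCore (multiplicativeGraph (hsAdjoint T) hT.map_star)
      (unitPair τ ρ) (star_unitPair hτ.posSemidef hρ.posSemidef) := by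
  have hcore := mul_inv_mem_invariantCore (y := T x) (x := x) hτ hρ
    (W := Subalgebra.toSubmodule (multiplicativeGraph (hsAdjoint T) hT.map_star).toSubalgebra)
    (σ := Set.Ioi (0 : ℝ)) (by rw [(Set.Ioi_infinite 0).encard_eq]; exact le_top)
    (fun s hs => hs.le)
    fun s hs => hTρ ▸ mulSumInv_mem_multiplicativeGraph hT hs hρ (hTρ ▸ hτ) (hTρ ▸ h s hs)
  exact fun k => invariantCore_le (zpow_smul_mem_invariantCore hcore k)

end Rigidity

section Blocks

variable {n k : ℕ} {A : Alg n}

/-- A `k × k` matrix over `A` as an operator on `ℂᵏ ⊗ ℂⁿ`. -/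
def block : Matrix (Fin k) (Fin k) A →⋆ₐ[ℂ] Matrix (Fin k × Fin n) (Fin k × Fin n) ℂ :=
  { (Matrix.compAlgEquiv (Fin k) (Fin n) ℂ ℂ).toAlgHom.comp A.subtype.toAlgHom.mapMatrix with
    map_star' := fun _ => rfl }

lemma block_apply (a : Matrix (Fin k) (Fin k) A) (p q : Fin k × Fin n) :
    block a p q = (a p.1 q.1 : Op n) p.2 q.2 := rfl

lemma block_injective : Function.Injective (block : Matrix (Fin k) (Fin k) A →⋆ₐ[ℂ] _) :=
  fun a b h => by
    ext i j x y
    exact congrFun (congrFun h (i, x)) (j, y)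

lemma trace_block (a : Matrix (Fin k) (Fin k) A) : (block a).trace = tr a.trace := by
  simp only [Matrix.trace, map_sum, Matrix.diag, block_apply, Fintype.sum_prod_type]
  rfl

lemma posSemidef_block_star_mul_self (a : Matrix (Fin k) (Fin k) A) :
    (block (star a * a)).PosSemidef := by
  rw [map_mul, map_star]
  exact Matrix.posSemidef_conjTranspose_mul_self _

lemma block_diagonal (c : A) : block (Matrix.diagonal fun _ : Fin k => c) =
    (1 : Matrix (Fin k) (Fin k) ℂ) ⊗ₖ (c : Op n) := by
  ext p q
  rw [block_apply, Matrix.kronecker_apply, Matrix.diagonal_apply, Matrix.one_apply]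
  split_ifs <;> simp

/-- The matrices with entries in a subalgebra. -/
def matrixAlg (P : StarSubalgebra ℂ A) (k : ℕ) : StarSubalgebra ℂ (Matrix (Fin k) (Fin k) A) :=
  { P.toSubalgebra.matrix with star_mem' := fun ha i j => star_mem (s := P) (ha j i) }

lemma trace_diagonal_mul_block_conj (ρ : A) (X d : Matrix (Fin k) (Fin k) A) :
    (((1 : Matrix (Fin k) (Fin k) ℂ) ⊗ₖ (ρ : Op n)) *
      ((block d).conjTranspose * block X * block d)).trace = tr (ρ * (star d * X * d).trace) := by
  rw [← block_diagonal, ← Matrix.star_eq_conjTranspose, ← map_star, ← map_mul, ← map_mul,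
    ← map_mul, trace_block]
  simp only [Matrix.trace, Matrix.diag, Matrix.diagonal_mul, Finset.mul_sum]

lemma posSemidef_block_of_tr_trace_nonneg (P : StarSubalgebra ℂ A) {ρ : A}
    (hρ : (ρ : Op n).PosDef) {X : Matrix (Fin k) (Fin k) A} (hX : ∀ i j, X i j ∈ P)
    (h : ∀ d : Matrix (Fin k) (Fin k) A, (∀ i j, d i j ∈ P) →
      0 ≤ tr (ρ * (star d * X * d).trace)) : (block X).PosSemidef := by
  refine posSemidef_of_trace_conj_nonneg (C := (matrixAlg P k).map block)
    (W := (1 : Matrix (Fin k) (Fin k) ℂ) ⊗ₖ (ρ : Op n)) (Matrix.PosDef.one.kronecker hρ)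
    ⟨X, hX, rfl⟩ ?_
  rintro _ ⟨d, hd, rfl⟩
  exact (h d hd).trans_eq (trace_diagonal_mul_block_conj ρ X d).symm

lemma tr_trace_nonneg_of_posSemidef_block {ρ : A} (hρ : (ρ : Op n).PosSemidef)
    {X : Matrix (Fin k) (Fin k) A} (hX : (block X).PosSemidef) (d : Matrix (Fin k) (Fin k) A) :
    0 ≤ tr (ρ * (star d * X * d).trace) :=
  (trace_mul_nonneg (Matrix.PosSemidef.one.kronecker hρ)
    (hX.conjTranspose_mul_mul_same (block d))).trans_eq (trace_diagonal_mul_block_conj ρ X d)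

end Blocks

section CompletelyPositive

variable {n m : ℕ} {A : Alg n} {B : Alg m} {Φ : A →ₗ[ℂ] B}

lemma IsCompletelyPositive.posSemidef_block_map (h : IsCompletelyPositive Φ) {k : ℕ}
    {a : Matrix (Fin k) (Fin k) A} (ha : (block a).PosSemidef) :
    (block (a.map Φ)).PosSemidef := h k a ha

lemma IsCompletelyPositive.posSemidef_block_two (h : IsCompletelyPositive Φ) (a : A) :
    (block !![Φ 1, Φ a; Φ (star a), Φ (star a * a)]).PosSemidef := by
  convert h.posSemidef_block_map
    (posSemidef_block_star_mul_self (!![1, a; 0, 0] : Matrix _ _ A)) using 2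
  ext i j
  fin_cases i <;> fin_cases j <;>
    simp [Matrix.mul_apply, Fin.sum_univ_two, Matrix.star_apply]

lemma IsCompletelyPositive.map_star (h : IsCompletelyPositive Φ) (a : A) :
    Φ (star a) = star (Φ a) :=
  (congrFun (congrFun (block_injective
    ((StarHomClass.map_star block _).trans (h.posSemidef_block_two a).isHermitian)) 1) 0).symm

lemma IsCompletelyPositive.isUnitalSchwarz (h : IsCompletelyPositive Φ) (h₁ : Φ 1 = 1) :
    IsUnitalSchwarz Φ := by
  refine ⟨h₁, fun a => ?_⟩
  -- The compression of `[Φ 1, Φ a; Φ a⋆, Φ (a⋆ a)]` by the column `(-Φ a, 1)`.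
  have hpos := ((h.posSemidef_block_two a).conjTranspose_mul_mul_same
    (block (!![-Φ a, 0; 1, 0] : Matrix (Fin 2) (Fin 2) B))).submatrix
    fun i : Fin m => ((0 : Fin 2), i)
  rw [← Matrix.star_eq_conjTranspose, ← StarHomClass.map_star, ← map_mul, ← map_mul] at hpos
  convert hpos using 1
  have hcorner : Φ (star a * a) - star (Φ a) * Φ a = (star (!![-Φ a, 0; 1, 0] : Matrix _ _ B) *
      !![Φ 1, Φ a; Φ (star a), Φ (star a * a)] * (!![-Φ a, 0; 1, 0] : Matrix _ _ B)) 0 0 := by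
    simp only [h₁, h.map_star, Matrix.mul_apply, Matrix.star_apply, Matrix.of_apply,
      Matrix.cons_val', Matrix.cons_val_zero, Matrix.cons_val_fin_one, Fin.sum_univ_two,
      star_neg, Matrix.cons_val_one, star_one, one_mul, mul_one, neg_add_cancel, zero_mul, zero_add]
    rw [sub_eq_neg_add]
    exact congrArg (· + _) (neg_mul (star (Φ a)) (Φ a)).symm
  rw [hcorner]
  rfl

lemma tr_trace_mul_map_hsAdjoint (h : ∀ b, hsAdjoint Φ (star b) = star (hsAdjoint Φ b)) {k : ℕ}
    (a : Matrix (Fin k) (Fin k) A) (b : Matrix (Fin k) (Fin k) B) :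
    tr (a * b.map (hsAdjoint Φ)).trace = tr (a.map Φ * b).trace := by
  simp only [Matrix.trace, Matrix.diag, Matrix.mul_apply, Matrix.map_apply, map_sum,
    tr_mul_hsAdjoint h]

lemma isCompletelyPositive_hsAdjoint (h : IsCompletelyPositive Φ) :
    IsCompletelyPositive (hsAdjoint Φ) := by
  intro k b hb
  have hstar := map_star_of_hsAdjoint (T := hsAdjoint Φ)
    (by rw [hsAdjoint_hsAdjoint]; exact h.map_star)
  refine posSemidef_block_of_tr_trace_nonneg ⊤ (ρ := (1 : A)) Matrix.PosDef.one
    (fun _ _ => StarSubalgebra.mem_top) (X := b.map (hsAdjoint Φ))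
    fun d _ => ?_
  have hd := h.posSemidef_block_map (posSemidef_block_star_mul_self (star d))
  rw [star_star] at hd
  calc 0 ≤ (block ((d * star d).map Φ) * block b).trace := trace_mul_nonneg hd hb
    _ = tr (d * star d * b.map (hsAdjoint Φ)).trace := by
      rw [← map_mul, trace_block, tr_trace_mul_map_hsAdjoint hstar]
    _ = tr (1 * (star d * b.map (hsAdjoint Φ) * d).trace) := by
      rw [one_mul, ← trace_block, ← trace_block, mul_assoc, map_mul, Matrix.trace_mul_comm,
        ← map_mul]

lemma isTracePreserving_hsAdjoint (h₁ : Φ 1 = 1) : IsTracePreserving (hsAdjoint Φ) :=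
  tr_map_of_hsAdjoint (by rwa [hsAdjoint_hsAdjoint])

lemma IsTracePreserving.hsAdjoint_one (h : IsTracePreserving Φ) : hsAdjoint Φ 1 = 1 :=
  hs_left_injective fun a => by
    rw [hs_hsAdjoint, hs_eq_tr, hs_eq_tr, star_one, one_mul, star_one, one_mul]
    exact h a

lemma isUnitalSchwarz_hsAdjoint (h : IsCompletelyPositive Φ) (htr : IsTracePreserving Φ) :
    IsUnitalSchwarz (hsAdjoint Φ) :=
  (isCompletelyPositive_hsAdjoint h).isUnitalSchwarz htr.hsAdjoint_one

end CompletelyPositive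

section Transfer

open ConjAct

variable {n m : ℕ} {A : Alg n} {B : Alg m} {G : StarSubalgebra ℂ (B × A)}

lemma eq_zero_of_tr_star_mul_self_eq_zero {ρ a : A} (hρ : (ρ : Op n).PosDef)
    (h : tr (ρ * (star a * a)) = 0) : a = 0 :=
  Subtype.ext (Matrix.conjTranspose_mul_self_eq_zero.1 (congrArg Subtype.val
    (eq_zero_of_tr_mul_eq_zero hρ (posSemidef_star_mul_self a) h)))

lemma eq_zero_of_tr_fst_eq_zero {τ : B} {ρ : A} (hτ : (τ : Op m).PosDef) (hρ : (ρ : Op n).PosDef)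
    (htr : ∀ v ∈ G, tr (τ * v.1) = tr (ρ * v.2)) {v : B × A} (hv : v ∈ G)
    (h : tr (τ * (star v.1 * v.1)) = 0) : v = 0 :=
  Prod.ext (eq_zero_of_tr_star_mul_self_eq_zero hτ h)
    (eq_zero_of_tr_star_mul_self_eq_zero hρ ((htr _ (mul_mem (star_mem hv) hv)).symm.trans h))

lemma exists_comp_eq_of_injective_dual {K V W : Type*} [Field K] [AddCommGroup V] [Module K V]
    [FiniteDimensional K V] [AddCommGroup W] [Module K W] (i : V →ₗ[K] W)
    (F : W →ₗ[K] Module.Dual K V) (h : ∀ v, F (i v) = 0 → v = 0) :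
    ∃ E : W →ₗ[K] V, ∀ w, F (i (E w)) = F w :=
  let e := LinearEquiv.ofInjectiveOfFinrankEq (F ∘ₗ i) ((injective_iff_map_eq_zero _).2 h)
    Subspace.dual_finrank_eq.symm
  ⟨e.symm.toLinearMap ∘ₗ F, fun w => e.apply_symm_apply (F w)⟩

lemma exists_projection {τ : B} {ρ : A} (hτ : (τ : Op m).PosDef) (hρ : (ρ : Op n).PosDef)
    (htr : ∀ v ∈ G, tr (τ * v.1) = tr (ρ * v.2)) :
    ∃ E : B →ₗ[ℂ] B × A, (∀ b, E b ∈ G) ∧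
      ∀ v ∈ G, ∀ b, tr (τ * (v.1 * (E b).1)) = tr (τ * (v.1 * b)) := by
  let V : Submodule ℂ (B × A) := Subalgebra.toSubmodule G.toSubalgebra
  let F : B →ₗ[ℂ] Module.Dual ℂ V :=
    ((LinearMap.mul ℂ B).compr₂ (tr ∘ₗ LinearMap.mulLeft ℂ τ)).flip.compl₂
      (LinearMap.fst ℂ B A ∘ₗ V.subtype)
  obtain ⟨E, hE⟩ := exists_comp_eq_of_injective_dual (V := V) (LinearMap.fst ℂ B A ∘ₗ V.subtype) F
    fun v hv => Subtype.ext <| eq_zero_of_tr_fst_eq_zero hτ hρ htr v.2 <|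
      LinearMap.congr_fun hv ⟨star (v : B × A), star_mem (s := G) v.2⟩
  exact ⟨V.subtype ∘ₗ E, fun b => (E b).2, fun v hv b => LinearMap.congr_fun (hE b) ⟨v, hv⟩⟩

/-- `Φ` maps into the second components of the algebra of pairs `G` and turns the sesquilinear
forms of the state `ρ` on them into those of the state `τ` on the first components. -/
structure IsTransfer (G : StarSubalgebra ℂ (B × A)) (τ : B) (ρ : A) (Φ : B →ₗ[ℂ] A) : Prop where
  mem : ∀ b, Φ b ∈ G.map (StarAlgHom.snd ℂ B A)
  tr_eq : ∀ v ∈ G, ∀ w ∈ G, ∀ b,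
    tr (ρ * (star v.2 * Φ b * w.2)) = tr (τ * (star v.1 * b * w.1))

lemma tr_mul_inv_smul (τ : Bˣ) (w v b : B) :
    tr ((τ : B) * ((toConjAct τ⁻¹ • w) * v * b)) = tr ((τ : B) * (v * b * w)) := by
  rw [units_smul_def, ofConjAct_toConjAct, inv_inv]
  simp only [mul_assoc, Units.mul_inv_cancel_left]
  rw [tr_mul_comm]
  simp only [mul_assoc]

lemma exists_isTransfer {τ : Bˣ} {ρ : Aˣ} (hτ : ((τ : B) : Op m).PosDef)
    (hρ : ((ρ : A) : Op n).PosDef) (htr : ∀ v ∈ G, tr ((τ : B) * v.1) = tr ((ρ : A) * v.2))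
    (hG : ∀ v ∈ G, toConjAct (unitPair τ ρ)⁻¹ • v ∈ G) : ∃ Φ, IsTransfer G (τ : B) (ρ : A) Φ := by
  obtain ⟨E, hEG, hE⟩ := exists_projection hτ hρ htr
  refine ⟨LinearMap.snd ℂ B A ∘ₗ E, fun b => ⟨E b, hEG b, rfl⟩, fun v hv w hw b => ?_⟩
  calc tr ((ρ : A) * (star v.2 * (E b).2 * w.2)) = tr ((τ : B) * (star v.1 * (E b).1 * w.1)) :=
        (htr _ (mul_mem (mul_mem (star_mem hv) (hEG b)) hw)).symm
    _ = tr ((τ : B) * ((toConjAct τ⁻¹ • w.1) * star v.1 * (E b).1)) := (tr_mul_inv_smul ..).symm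
    _ = tr ((τ : B) * ((toConjAct τ⁻¹ • w.1) * star v.1 * b)) :=
        hE _ (mul_mem (hG w hw) (star_mem hv)) b
    _ = tr ((τ : B) * (star v.1 * b * w.1)) := tr_mul_inv_smul ..

variable {Φ : B →ₗ[ℂ] A}

lemma IsTransfer.map_one {τ : B} {ρ : A} (h : IsTransfer G τ ρ Φ) (hρ : (ρ : Op n).PosDef)
    (htr : ∀ v ∈ G, tr (τ * v.1) = tr (ρ * v.2)) : Φ 1 = 1 := by
  obtain ⟨v, hv, hvΦ : v.2 = Φ 1⟩ := h.mem 1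
  have horth : ∀ w ∈ G, tr (ρ * (star w.2 * (Φ 1 - 1))) = 0 := fun w hw => by
    have hw₁ := h.tr_eq w hw 1 (one_mem G) 1
    simp only [Prod.fst_one, Prod.snd_one, mul_one] at hw₁
    rw [mul_sub, mul_one, mul_sub, map_sub, hw₁, sub_eq_zero]
    exact htr (star w) (star_mem hw)
  refine sub_eq_zero.1 (eq_zero_of_tr_star_mul_self_eq_zero hρ ?_)
  have := horth (v - 1) (sub_mem hv (one_mem G))
  rwa [Prod.snd_sub, Prod.snd_one, hvΦ] at this

lemma IsTransfer.isCompletelyPositive {τ : B} {ρ : A} (h : IsTransfer G τ ρ Φ)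
    (hτ : (τ : Op m).PosSemidef) (hρ : (ρ : Op n).PosDef) : IsCompletelyPositive Φ := by
  intro k b hb
  refine posSemidef_block_of_tr_trace_nonneg (X := b.map Φ) (G.map (StarAlgHom.snd ℂ B A)) hρ
    (fun i j => h.mem (b i j)) fun d hd => ?_
  choose v hv hvd using hd
  obtain rfl : (Matrix.of fun i j => (v i j).2) = d := Matrix.ext hvd
  convert tr_trace_nonneg_of_posSemidef_block hτ hb (Matrix.of fun i j => (v i j).1) using 1
  simp only [Matrix.trace, Matrix.diag, Matrix.mul_apply, Finset.sum_mul, Finset.mul_sum, map_sum,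
    Matrix.map_apply, Matrix.star_apply, Matrix.of_apply, h.tr_eq _ (hv _ _) _ (hv _ _)]

lemma IsTransfer.hsAdjoint_mul {τ : B} {ρ : A} (h : IsTransfer G τ ρ Φ)
    (hτ : (τ : Op m).PosSemidef) (hρ : (ρ : Op n).PosSemidef) {v : B × A} (hv : v ∈ G) :
    hsAdjoint Φ (v.2 * ρ) = v.1 * τ := by
  refine hs_left_injective fun b => ?_
  have hvb := h.tr_eq v hv 1 (one_mem G) b
  rw [Prod.snd_one, Prod.fst_one, mul_one, mul_one] at hvb
  rw [hs_hsAdjoint, hs_eq_tr, hs_eq_tr, star_mul, star_mul, star_eq_of_posSemidef hτ,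
    star_eq_of_posSemidef hρ, mul_assoc, mul_assoc, hvb]

lemma exists_channel {τ : Bˣ} {ρ : Aˣ} (hτ : ((τ : B) : Op m).PosDef)
    (hρ : ((ρ : A) : Op n).PosDef) (htr : ∀ v ∈ G, tr ((τ : B) * v.1) = tr ((ρ : A) * v.2))
    (hG : ∀ v ∈ G, toConjAct (unitPair τ ρ)⁻¹ • v ∈ G) :
    ∃ Ψ : A →ₗ[ℂ] B, IsCompletelyPositive Ψ ∧ IsTracePreserving Ψ ∧
      ∀ v ∈ G, Ψ (v.2 * (ρ : A)) = v.1 * (τ : B) := by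
  obtain ⟨Φ, hΦ⟩ := exists_isTransfer hτ hρ htr hG
  exact ⟨hsAdjoint Φ, isCompletelyPositive_hsAdjoint (hΦ.isCompletelyPositive hτ.posSemidef hρ),
    isTracePreserving_hsAdjoint (hΦ.map_one hρ htr),
    fun _ hv => hΦ.hsAdjoint_mul hτ.posSemidef hρ.posSemidef hv⟩

lemma exists_channel_swap {τ : Bˣ} {ρ : Aˣ} (hτ : ((τ : B) : Op m).PosDef)
    (hρ : ((ρ : A) : Op n).PosDef) (htr : ∀ v ∈ G, tr ((τ : B) * v.1) = tr ((ρ : A) * v.2))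
    (hG : ∀ v ∈ G, toConjAct (unitPair τ ρ)⁻¹ • v ∈ G) :
    ∃ R : B →ₗ[ℂ] A, IsCompletelyPositive R ∧ IsTracePreserving R ∧
      ∀ v ∈ G, R (v.1 * (τ : B)) = v.2 * (ρ : A) := by
  obtain ⟨R, hcp, htp, hR⟩ := exists_channel (τ := ρ) (ρ := τ)
    (G := G.map ((StarAlgHom.snd ℂ B A).prod (StarAlgHom.fst ℂ B A))) hρ hτ
    (by rintro _ ⟨v, hv, rfl⟩; exact (htr v hv).symm)
    (by rintro _ ⟨v, hv, rfl⟩; exact ⟨_, hG v hv, rfl⟩)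
  exact ⟨R, hcp, htp, fun v hv => hR _ ⟨v, hv, rfl⟩⟩

end Transfer

section Channels

variable {n m : ℕ} {A : Alg n} {B : Alg m} {T : A →ₗ[ℂ] B}

lemma exists_channels (hT : IsUnitalSchwarz (hsAdjoint T)) {ρ : A} (hρ : (ρ : Op n).PosDef)
    (hτ : (T ρ : Op m).PosDef) :
    ∃ (Ψ : A →ₗ[ℂ] B) (R : B →ₗ[ℂ] A), (IsCompletelyPositive Ψ ∧ IsTracePreserving Ψ) ∧
      (IsCompletelyPositive R ∧ IsTracePreserving R) ∧
      ∀ x, (∀ s : ℝ, 0 < s → invForm s (T ρ) (T x) = invForm s ρ x) → Ψ x = T x ∧ R (T x) = x := by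
  obtain ⟨ρ, rfl⟩ := isUnit_of_posDef hρ
  obtain ⟨τ, hTρ⟩ := isUnit_of_posDef hτ
  rw [← hTρ] at hτ ⊢
  let G := conjCore (multiplicativeGraph (hsAdjoint T) hT.map_star) (unitPair τ ρ)
    (star_unitPair hτ.posSemidef hρ.posSemidef)
  have htr : ∀ v ∈ G, tr ((τ : B) * v.1) = tr ((ρ : A) * v.2) := fun v hv => by
    rw [hTρ, ← tr_mul_hsAdjoint hT.map_star, map_fst_of_mem_multiplicativeGraph hT.1
      (conjCore_le hv)]
  have hG : ∀ v ∈ G, ConjAct.toConjAct (unitPair τ ρ)⁻¹ • v ∈ G := fun _ => inv_smul_mem_conjCore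
  obtain ⟨Ψ, hΨcp, hΨtp, hΨ⟩ := exists_channel hτ hρ htr hG
  obtain ⟨R, hRcp, hRtp, hR⟩ := exists_channel_swap hτ hρ htr hG
  refine ⟨Ψ, R, ⟨hΨcp, hΨtp⟩, ⟨hRcp, hRtp⟩, fun x hx => ?_⟩
  have hmem : (T x * ↑τ⁻¹, x * ↑ρ⁻¹) ∈ G := mul_inv_mem_conjCore hT hTρ.symm hρ hτ hx
  have hΨx := hΨ _ hmem
  have hRx := hR _ hmem
  rw [Units.inv_mul_cancel_right, Units.inv_mul_cancel_right] at hΨx hRx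
  exact ⟨hΨx, hRx⟩

end Channels

section MonotoneMetric

lemma map_ringInverse {M N : Type*} [MonoidWithZero M] [MonoidWithZero N] (e : M ≃* N) (x : M) :
    e (Ring.inverse x) = Ring.inverse (e x) := by
  by_cases hx : IsUnit x
  · obtain ⟨u, rfl⟩ := hx
    rw [Ring.inverse_unit]
    exact (Ring.inverse_unit (Units.map e.toMonoidHom u)).symm
  · rw [Ring.inverse_non_unit x hx, Ring.inverse_non_unit _ (mt (isUnit_map_iff e x).1 hx),
      map_zero]

lemma contDiffAt_ringInverse_mulSum_apply {E C : Type*} [NormedAddCommGroup E] [NormedSpace ℝ E]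
    [NormedRing C] [NormedAlgebra ℂ C] [FiniteDimensional ℂ C] {s : ℝ} {γ : E → C} {u : E}
    (hγ : ContDiffAt ℝ ∞ γ u) (hu : IsUnit (mulSum s (γ u))) (x : C) :
    ContDiffAt ℝ ∞ (fun v => Ring.inverse (mulSum s (γ v)) x) u := by
  have : CompleteSpace C := FiniteDimensional.complete ℂ C
  let e : Module.End ℂ C ≃ₐ[ℂ] (C →L[ℂ] C) := Module.End.toContinuousLinearMap C
  let ℓ : C →L[ℂ] (C →L[ℂ] C) :=
    (s : ℂ) • (ContinuousLinearMap.mul ℂ C).flip + ContinuousLinearMap.mul ℂ C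
  have hℓ (c : C) : ℓ c = e (mulSum s c) := rfl
  have hinv (v : E) : Ring.inverse (mulSum s (γ v)) x = Ring.inverse (ℓ (γ v)) x :=
    DFunLike.congr_fun (map_ringInverse e.toMulEquiv (mulSum s (γ v))) x
  obtain ⟨w, hw⟩ := hu.map e
  have hdiff : ContDiffAt ℝ ∞ Ring.inverse (ℓ (γ u)) := by
    rw [hℓ, ← hw]
    exact contDiffAt_ringInverse ℝ w
  simp only [hinv]
  have hpath : ContDiffAt ℝ ∞ (fun v => ℓ (γ v)) u :=
    (ℓ.contDiff.restrict_scalars ℝ).contDiffAt.comp u hγ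
  have hcomp : ContDiffAt ℝ ∞ (fun v => Ring.inverse (ℓ (γ v))) u :=
    ContDiffAt.comp (g := Ring.inverse) u hdiff hpath
  exact ((ContinuousLinearMap.apply ℂ C x).contDiff.restrict_scalars ℝ).contDiffAt.comp u hcomp

variable {n : ℕ} {A : Alg n} {s : ℝ} {ρ : A}

open scoped Matrix.Norms.L2Operator in
lemma contDiffAt_re_hs_mulSumInv (hs₀ : 0 ≤ s) (hρ : (ρ : Op n).PosDef) (x y : A) {k : ℕ}
    (z : Fin k → A) : ContDiffAt ℝ ∞
      (fun u : Fin k → ℝ => (hs (mulSumInv s (ρ + ∑ i, u i • z i) x) y).re) 0 := by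
  have hpath : ContDiffAt ℝ ∞ (fun u : Fin k → ℝ => ρ + ∑ i, u i • z i) 0 := by fun_prop
  have hzero : ρ + ∑ i, (0 : Fin k → ℝ) i • z i = ρ := by simp
  have hinv := contDiffAt_ringInverse_mulSum_apply hpath
    (by rw [hzero]; exact isUnit_mulSum hs₀ hρ) x
  have hre : ContDiff ℝ ∞ fun a : A => (hs a y).re := by
    have hre_eq (a : A) : (hs a y).re = (tr (star y * a)).re := by
      rw [← hs_eq_tr, ← star_hs, RCLike.star_def, Complex.conj_re]
    simp only [hre_eq]
    exact Complex.reCLM.contDiff.comp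
      ((tr ∘ₗ LinearMap.mulLeft ℂ (star y)).toContinuousLinearMap.contDiff.restrict_scalars ℝ)
  exact hre.contDiffAt.comp 0 hinv

lemma IsUnitalSchwarz.posDef_map {m : ℕ} {B : Alg m} {T : A →ₗ[ℂ] B}
    (hT : IsUnitalSchwarz (hsAdjoint T)) (hρ : (ρ : Op n).PosSemidef) (hu : IsUnit (T ρ)) :
    (T ρ : Op m).PosDef :=
  posDef_of_isUnit (posSemidef_map_of_hsAdjoint hT.posSemidef_map hρ) hu

lemma invForm_nonneg (hs₀ : 0 ≤ s) (hρ : (ρ : Op n).PosDef) (x : A) : 0 ≤ invForm s ρ x := by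
  rw [invForm_eq_hs_mulSum hs₀ hρ]
  exact hs_mulSum_self_nonneg hs₀ hρ.posSemidef _

lemma eq_zero_of_invForm_eq_zero (hs₀ : 0 ≤ s) (hρ : (ρ : Op n).PosDef) {x : A}
    (h : invForm s ρ x = 0) : x = 0 := by
  rw [invForm_eq_hs_mulSum hs₀ hρ] at h
  rw [← mulSum_mulSumInv hs₀ hρ x, eq_zero_of_hs_mulSum_self_eq_zero hs₀ hρ h, map_zero]

theorem isMonotoneMetric_re_hs_mulSumInv (hs₀ : 0 ≤ s) :
    IsMonotoneMetric fun _ _ ρ x y => (hs (mulSumInv s ρ x) y).re where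
  add_left n A ρ _ _ x y z _ _ _ := by
    simp only [map_add, hs_eq_tr, star_add, add_mul, Complex.add_re]
  smul_left n A ρ _ _ c x y _ _ := by
    simp only [← Complex.coe_smul, map_smul, hs_eq_tr, star_smul, smul_mul_assoc, RCLike.star_def,
      Complex.conj_ofReal, smul_eq_mul, Complex.re_ofReal_mul]
  symm n A ρ hρ hu x y _ _ := by
    rw [hs_mulSumInv_left hs₀ (posDef_of_isUnit hρ.1 hu), ← star_hs, RCLike.star_def,
      Complex.conj_re]
  pos n A ρ hρ hu x _ hx := by
    have hpd := posDef_of_isUnit hρ.1 hu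
    exact (Complex.pos_iff.1 <| (invForm_nonneg hs₀ hpd x).lt_of_ne' <|
      mt (eq_zero_of_invForm_eq_zero hs₀ hpd) hx).1
  smooth n A ρ hρ hu x y _ _ k z _ :=
    contDiffAt_re_hs_mulSumInv hs₀ (posDef_of_isUnit hρ.1 hu) x y z
  monotone n m A B T hcp htr ρ hρ hu hTu x _ := by
    have hT := isUnitalSchwarz_hsAdjoint hcp htr
    exact (Complex.le_def.1 (invForm_map_le hT hs₀ (posDef_of_isUnit hρ.1 hu)
      (hT.posDef_map hρ.1 hTu) x)).1

end MonotoneMetric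

section SpectralFormula

open Matrix

lemma continuousOn_spectrum {ι : Type*} [Fintype ι] [DecidableEq ι] (D : Matrix ι ι ℂ) (f : ℝ → ℝ) :
    ContinuousOn f (spectrum ℝ D) := D.finite_real_spectrum.continuousOn f

lemma cfc_mul_cfc_inv {ι : Type*} [Fintype ι] [DecidableEq ι] {D : Matrix ι ι ℂ}
    (hD : D.PosDef) {f : ℝ → ℝ} (hf : ∀ t, 0 < t → 0 < f t) :
    cfc f D * cfc (fun t => (f t)⁻¹) D = 1 := by
  have hsa : IsSelfAdjoint D := hD.isHermitian
  rw [← cfc_mul _ _ D (continuousOn_spectrum D _) (continuousOn_spectrum D _), ← cfc_const_one ℝ D]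
  refine cfc_congr fun t ht => mul_inv_cancel₀ (hf t ?_).ne'
  rw [hD.isHermitian.spectrum_real_eq_range_eigenvalues] at ht
  obtain ⟨i, rfl⟩ := ht
  exact hD.eigenvalues_pos i

lemma exists_cfc_eq_sum {ι : Type*} [Fintype ι] [DecidableEq ι] {D : Matrix ι ι ℂ}
    (hD : D.IsHermitian) : ∃ P : ι → Matrix ι ι ℂ, ∀ g : ℝ → ℝ,
      cfc g D = ∑ i, (g (hD.eigenvalues i) : ℂ) • P i := by
  let L : (ι → ℂ) →ₗ[ℂ] Matrix ι ι ℂ :=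
    LinearMap.mulLeft ℂ (hD.eigenvectorUnitary : Matrix ι ι ℂ) ∘ₗ
      LinearMap.mulRight ℂ (star hD.eigenvectorUnitary : Matrix ι ι ℂ) ∘ₗ
        diagonalLinearMap ι ℂ ℂ
  refine ⟨fun i => L fun j => if i = j then 1 else 0, fun g => ?_⟩
  rw [hD.cfc_eq, IsHermitian.cfc, Unitary.conjStarAlgAut_apply, mul_assoc]
  exact L.pi_apply_eq_sum_univ _

variable {n : ℕ} {ρ : Op n}

lemma metric_eq_dotProduct (f : ℝ → ℝ) (ρ x y : Op n) :
    metric f ρ x y = (J f ρ)⁻¹ *ᵥ x.vec ⬝ᵥ yᵀ.vec := by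
  have hvec : (J f ρ)⁻¹ *ᵥ x.vec = (JInv f ρ x).vec := rfl
  rw [hvec, vec_dotProduct_vec, ← transpose_mul, trace_transpose, trace_mul_comm, metric]

lemma posDef_modular (hρ : ρ.PosDef) : (modular ρ).PosDef := hρ.inv.transpose.kronecker hρ

lemma J_inv (hρ : ρ.PosDef) {f : ℝ → ℝ} (hf : ∀ t, 0 < t → 0 < f t) :
    (J f ρ)⁻¹ = (rightMul ρ)⁻¹ * cfc (fun t => (f t)⁻¹) (modular ρ) := by
  rw [J, Matrix.mul_inv_rev, Matrix.inv_eq_right_inv (cfc_mul_cfc_inv (posDef_modular hρ) hf)]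

lemma exists_metric_eq_sum (hρ : ρ.PosDef) (x y : Op n) :
    ∃ (u : Fin n × Fin n → ℝ) (μ : Fin n × Fin n → ℂ), (∀ i, 0 < u i) ∧
      ∀ f : ℝ → ℝ, (∀ t, 0 < t → 0 < f t) → metric f ρ x y = ∑ i, μ i * ((f (u i))⁻¹ : ℝ) := by
  obtain ⟨P, hP⟩ := exists_cfc_eq_sum (posDef_modular hρ).isHermitian
  refine ⟨_, fun i => ((rightMul ρ)⁻¹ * P i) *ᵥ x.vec ⬝ᵥ yᵀ.vec,
    (posDef_modular hρ).eigenvalues_pos, fun f hf => ?_⟩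
  simp only [metric_eq_dotProduct, J_inv hρ hf, hP, Matrix.mul_sum, Matrix.mul_smul,
    Matrix.sum_mulVec, smul_mulVec, sum_dotProduct, smul_dotProduct, smul_eq_mul, mul_comm]

lemma J_const_add_mulVec (hρ : ρ.PosDef) (s : ℝ) (b : Op n) :
    J (fun t => s + t) ρ *ᵥ b.vec = (mulSum s ρ b).vec := by
  have hsa : IsSelfAdjoint (modular ρ) := (posDef_modular hρ).isHermitian
  have hinv : ρ * b * ρ * ρ⁻¹ = ρ * b :=
    mul_nonsing_inv_cancel_right _ _ ((isUnit_iff_isUnit_det _).1 hρ.isUnit)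
  rw [J, cfc_const_add s (fun t => t) (modular ρ) (continuousOn_spectrum _ _),
    cfc_id' ℝ (modular ρ), ← mulVec_mulVec, rightMul_mulVec, add_mulVec, modular_mulVec,
    ← mul_assoc, hinv, Algebra.algebraMap_eq_smul_one, smul_mulVec, one_mulVec]
  rfl

lemma isUnit_J (hρ : ρ.PosDef) {f : ℝ → ℝ} (hf : ∀ t, 0 < t → 0 < f t) : IsUnit (J f ρ) :=
  (IsUnit.of_mul_eq_one _ (cfc_mul_cfc_inv (posDef_modular hρ) hf)).mul
    (hρ.transpose.kronecker PosDef.one).isUnit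

end SpectralFormula

section MetricComparison

variable {n m : ℕ} {A : Alg n} {B : Alg m} {ρ x : A} {τ y : B} {s : ℝ}

open Matrix in
lemma JInv_const_add (hs₀ : 0 ≤ s) (hρ : (ρ : Op n).PosDef) (x : A) :
    JInv (fun t => s + t) (ρ : Op n) x = (mulSumInv s ρ x : A) := by
  have hx : (x : Op n) = mulSum s (ρ : Op n) (mulSumInv s ρ x) :=
    congrArg Subtype.val (mulSum_mulSumInv hs₀ hρ x).symm
  have hJ : IsUnit (J (fun t => s + t) (ρ : Op n)) := isUnit_J hρ fun t ht => by positivity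
  have hvec : (J (fun t => s + t) (ρ : Op n))⁻¹ *ᵥ (x : Op n).vec =
      (mulSumInv s ρ x : Op n).vec := by
    rw [hx, ← J_const_add_mulVec hρ, mulVec_mulVec,
      nonsing_inv_mul _ ((isUnit_iff_isUnit_det _).1 hJ), one_mulVec]
  exact vec_inj.1 hvec

theorem metric_const_add (hs₀ : 0 ≤ s) (hρ : (ρ : Op n).PosDef) (hx : star x = x) :
    metric (fun t => s + t) (ρ : Op n) x x = invForm s ρ x := by
  have hmetric : metric (fun t => s + t) (ρ : Op n) x x = tr (mulSumInv s ρ x * x) := by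
    rw [metric, JInv_const_add hs₀ hρ]
    rfl
  rw [hmetric, tr_mul_comm, ← (IsSelfAdjoint.of_nonneg (invForm_nonneg hs₀ hρ x)).star_eq, invForm,
    star_hs, hs_eq_tr, hx]

lemma exists_metric_sub_metric_eq_sum {ρ : Op n} {τ : Op m} (hρ : ρ.PosDef) (hτ : τ.PosDef)
    (x : Op n) (y : Op m) :
    ∃ (u : Fin n × Fin n ⊕ Fin m × Fin m → ℝ) (μ : Fin n × Fin n ⊕ Fin m × Fin m → ℂ),
      (∀ i, 0 < u i) ∧ ∀ f : ℝ → ℝ, (∀ t, 0 < t → 0 < f t) →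
        metric f ρ x x - metric f τ y y = ∑ i, μ i * ((f (u i))⁻¹ : ℝ) := by
  obtain ⟨u, μ, hu, hμ⟩ := exists_metric_eq_sum hρ x x
  obtain ⟨v, κ, hv, hκ⟩ := exists_metric_eq_sum hτ y y
  refine ⟨Sum.elim u v, Sum.elim μ (-κ), Sum.forall.2 ⟨hu, hv⟩, fun f hf => ?_⟩
  simp only [hμ f hf, hκ f hf, Fintype.sum_sum_type, Sum.elim_inl, Sum.elim_inr, Pi.neg_apply,
    neg_mul, Finset.sum_neg_distrib, sub_eq_add_neg]

lemma exists_invForm_sub_invForm_eq_sum (hρ : (ρ : Op n).PosDef) (hτ : (τ : Op m).PosDef)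
    (hx : star x = x) (hy : star y = y) :
    ∃ (u : Fin n × Fin n ⊕ Fin m × Fin m → ℝ) (μ : Fin n × Fin n ⊕ Fin m × Fin m → ℂ),
      (∀ i, 0 < u i) ∧
      (∀ f : ℝ → ℝ, (∀ t, 0 < t → 0 < f t) →
        metric f (ρ : Op n) x x - metric f (τ : Op m) y y = ∑ i, μ i * ((f (u i))⁻¹ : ℝ)) ∧
      ∀ s, 0 ≤ s → invForm s ρ x - invForm s τ y = ∑ i, μ i * ((s + u i)⁻¹ : ℝ) := by
  obtain ⟨u, μ, hu, hμ⟩ := exists_metric_sub_metric_eq_sum hρ hτ (x : Op n) (y : Op m)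
  refine ⟨u, μ, hu, hμ, fun s hs₀ => ?_⟩
  rw [← metric_const_add hs₀ hρ hx, ← metric_const_add hs₀ hτ hy]
  exact hμ _ fun t ht => by positivity

theorem metric_eq_of_forall_invForm_eq (hρ : (ρ : Op n).PosDef) (hτ : (τ : Op m).PosDef)
    (hx : star x = x) (hy : star y = y) (h : ∀ s, 0 < s → invForm s τ y = invForm s ρ x)
    {f : ℝ → ℝ} (hf : ∀ t, 0 < t → 0 < f t) :
    metric f (ρ : Op n) x x = metric f (τ : Op m) y y := by
  obtain ⟨u, μ, hu, hμ, hform⟩ := exists_invForm_sub_invForm_eq_sum hρ hτ hx hy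
  have hzero (s : ℝ) (hs : 0 < s) : ∑ i, μ i * ((s + u i)⁻¹ : ℝ) = 0 := by
    rw [← hform s hs.le, h s hs, sub_self]
  rw [← sub_eq_zero, hμ f hf]
  exact sum_mul_eq_zero_of_sum_mul_inv_add_eq_zero hu hzero fun t => ((f t)⁻¹ : ℝ)

end MetricComparison

section RepresentingMeasure

open MeasureTheory Filter Topology

lemma sum_nonneg_of_sum_mul_inv_add_nonneg {ι : Type*} [Fintype ι] {u μ : ι → ℝ}
    (h : ∀ s, 0 ≤ s → 0 ≤ ∑ i, μ i * (s + u i)⁻¹) : 0 ≤ ∑ i, μ i := by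
  have hratio (w : ℝ) : Tendsto (fun s : ℝ => s * (s + w)⁻¹) atTop (𝓝 1) := by
    have hsub : Tendsto (fun s : ℝ => 1 - w * (s + w)⁻¹) atTop (𝓝 (1 - w * 0)) :=
      ((tendsto_inv_atTop_zero.comp (tendsto_atTop_add_const_right _ w tendsto_id)).const_mul
        w).const_sub 1
    rw [mul_zero, sub_zero] at hsub
    refine hsub.congr' ((eventually_gt_atTop (-w)).mono fun s hs => ?_)
    have hsw : s + w ≠ 0 := by linarith
    field_simp
    ring
  have hlim : Tendsto (fun s : ℝ => ∑ i, μ i * (s * (s + u i)⁻¹)) atTop (𝓝 (∑ i, μ i * 1)) :=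
    tendsto_finsetSum _ fun i _ => (hratio (u i)).const_mul (μ i)
  simp only [mul_one] at hlim
  refine ge_of_tendsto hlim ((eventually_ge_atTop 0).mono fun s hs => ?_)
  simpa only [Finset.mul_sum, mul_left_comm] using mul_nonneg hs (h s hs)

lemma IsRepresentingMeasure.integral_sum {f : ℝ → ℝ} {ν : Measure ℝ}
    (hν : IsRepresentingMeasure f ν) {ι : Type*} [Fintype ι] {u : ι → ℝ} (hu : ∀ i, 0 < u i)
    (μ : ι → ℝ) :
    Integrable (fun s => ∑ i, μ i * (s + u i)⁻¹) ν ∧ ∃ c, 0 ≤ c ∧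
      ∫ s, ∑ i, μ i * (s + u i)⁻¹ ∂ν = ∑ i, μ i * (f (u i))⁻¹ - c * ∑ i, μ i := by
  obtain ⟨-, c, hc, hrep⟩ := hν
  have hint (i : ι) : Integrable (fun s => μ i * (s + u i)⁻¹) ν := (hrep _ (hu i)).1.const_mul _
  refine ⟨integrable_finsetSum _ fun i _ => hint i, c, hc, ?_⟩
  rw [integral_finsetSum _ fun i _ => hint i, Finset.mul_sum, ← Finset.sum_sub_distrib]
  refine Finset.sum_congr rfl fun i _ => ?_
  rw [integral_const_mul, (hrep _ (hu i)).2]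
  ring

lemma IsRepresentingMeasure.ae_nonneg {f : ℝ → ℝ} {ν : Measure ℝ}
    (hν : IsRepresentingMeasure f ν) : ∀ᵐ s ∂ν, 0 ≤ s := by
  simp only [ae_iff, not_le]
  exact hν.1

lemma IsRepresentingMeasure.nonneg_and_sum_eq_zero {f : ℝ → ℝ} {ν : Measure ℝ}
    (hν : IsRepresentingMeasure f ν) {ι : Type*} [Fintype ι] {u μ : ι → ℝ} (hu : ∀ i, 0 < u i)
    (hnonneg : ∀ s, 0 ≤ s → 0 ≤ ∑ i, μ i * (s + u i)⁻¹) (h : ∑ i, μ i * (f (u i))⁻¹ = 0) {s : ℝ}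
    (hs : s ∈ ν.support) : 0 ≤ s ∧ ∑ i, μ i * (s + u i)⁻¹ = 0 := by
  set d : ℝ → ℝ := fun s => ∑ i, μ i * (s + u i)⁻¹
  obtain ⟨hint, c, hc, hintegral⟩ := hν.integral_sum hu μ
  have hd : ∀ᵐ s ∂ν, 0 ≤ d s := hν.ae_nonneg.mono hnonneg
  have hle : ∫ s, d s ∂ν ≤ 0 := by
    rw [hintegral, h, zero_sub, neg_nonpos]
    exact mul_nonneg hc (sum_nonneg_of_sum_mul_inv_add_nonneg hnonneg)
  have hzero : d =ᵐ[ν] 0 :=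
    (integral_eq_zero_iff_of_nonneg_ae hd hint).1 (hle.antisymm (integral_nonneg_of_ae hd))
  have hcont : ContinuousOn d (Set.Ici 0) := continuousOn_finsetSum _ fun i _ =>
    continuousOn_const.mul <| ContinuousOn.inv₀ (by fun_prop) fun s hs =>
      (add_pos_of_nonneg_of_pos hs (hu i)).ne'
  have hclosed : IsClosed (Set.Ici 0 ∩ d ⁻¹' {0}) :=
    hcont.preimage_isClosed_of_isClosed isClosed_Ici isClosed_singleton
  exact Measure.support_subset_of_isClosed hclosed (hν.ae_nonneg.and hzero) hs

variable {n m : ℕ} {A : Alg n} {B : Alg m} {ρ x : A} {τ y : B}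

theorem invForm_eq_of_mem_support (hρ : (ρ : Op n).PosDef) (hτ : (τ : Op m).PosDef)
    (hx : star x = x) (hy : star y = y) (hle : ∀ s, 0 ≤ s → invForm s τ y ≤ invForm s ρ x)
    {f : ℝ → ℝ} (hf : ∀ t, 0 < t → 0 < f t) {ν : Measure ℝ} (hν : IsRepresentingMeasure f ν)
    (h : metric f (ρ : Op n) x x = metric f (τ : Op m) y y) {s : ℝ} (hs : s ∈ ν.support) :
    0 ≤ s ∧ invForm s τ y = invForm s ρ x := by
  obtain ⟨u, μ, hu, hμ, hform⟩ := exists_invForm_sub_invForm_eq_sum hρ hτ hx hy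
  have hre (g : ℝ → ℝ) : (∑ i, μ i * (g (u i) : ℂ)).re = ∑ i, (μ i).re * g (u i) := by
    simp only [Complex.re_sum, Complex.re_mul_ofReal]
  have hgap (r : ℝ) (hr : 0 ≤ r) : 0 ≤ invForm r ρ x - invForm r τ y := sub_nonneg.2 (hle r hr)
  have hgap_re (r : ℝ) (hr : 0 ≤ r) :
      (invForm r ρ x - invForm r τ y).re = ∑ i, (μ i).re * (r + u i)⁻¹ := by
    rw [hform r hr]
    exact hre fun t => (r + t)⁻¹
  have hmetric : ∑ i, (μ i).re * (f (u i))⁻¹ = 0 := by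
    rw [← hre fun t => (f t)⁻¹, ← hμ f hf, h, sub_self, Complex.zero_re]
  obtain ⟨hs₀, hsum⟩ := hν.nonneg_and_sum_eq_zero hu
    (fun r hr => (hgap_re r hr).symm ▸ (Complex.nonneg_iff.1 (hgap r hr)).1) hmetric hs
  have him := (Complex.nonneg_iff.1 (hgap s hs₀)).2
  exact ⟨hs₀, (sub_eq_zero.1 (Complex.ext ((hgap_re s hs₀).trans hsum) him.symm)).symm⟩

end RepresentingMeasure

section SquareRoot

open MeasureTheory Set

lemma isOperatorMonotone_sqrt : IsOperatorMonotone Real.sqrt := by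
  intro k a b ha hb hab
  open scoped MatrixOrder Matrix.Norms.L2Operator in
  rw [← Matrix.le_iff] at hab ⊢
  rw [← cfcₙ_eq_cfc (f := Real.sqrt) (a := a), ← cfcₙ_eq_cfc (f := Real.sqrt) (a := b),
    ← CFC.sqrt_eq_real_sqrt a ha.posSemidef.nonneg, ← CFC.sqrt_eq_real_sqrt b hb.posSemidef.nonneg]
  exact CFC.sqrt_le_sqrt a b hab

lemma isSymmOperatorMonotone_sqrt : IsSymmOperatorMonotone Real.sqrt where
  pos _ := Real.sqrt_pos.2
  symm t _ := by rw [Real.sqrt_inv, ← div_eq_mul_inv, Real.div_sqrt]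
  operatorMonotone := isOperatorMonotone_sqrt

/-- The density `s ↦ C s^{-1/2}` of the representing measure of the square root. -/
noncomputable def sqrtDensity (s : ℝ) : NNReal :=
  Real.toNNReal ((∫ t in Ioi 0, Real.rpowIntegrand₀₁ (1 / 2) t 1)⁻¹ * s ^ (-(1 / 2) : ℝ))

/-- The representing measure of the square root on `[0, ∞)`. -/
noncomputable def sqrtMeasure : Measure ℝ :=
  (volume.restrict (Ioi 0)).withDensity fun s => sqrtDensity s

lemma measurable_sqrtDensity : Measurable sqrtDensity :=
  ((measurable_id.pow_const _).const_mul _).real_toNNReal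

lemma one_half_mem_Ioo : (1 / 2 : ℝ) ∈ Ioo (0 : ℝ) 1 := by norm_num

lemma coe_sqrtDensity {s : ℝ} (hs : 0 < s) : (sqrtDensity s : ℝ) =
    (∫ t in Ioi 0, Real.rpowIntegrand₀₁ (1 / 2) t 1)⁻¹ * s ^ (-(1 / 2) : ℝ) := by
  have := Real.integral_rpowIntegrand₀₁_one_pos one_half_mem_Ioo
  exact Real.coe_toNNReal _ (by positivity)

lemma coe_sqrtDensity_pos {s : ℝ} (hs : 0 < s) : 0 < (sqrtDensity s : ℝ) := by
  have := Real.integral_rpowIntegrand₀₁_one_pos one_half_mem_Ioo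
  rw [coe_sqrtDensity hs]
  positivity

lemma sqrtDensity_smul_inv_add {s t : ℝ} (hs : 0 < s) (ht : 0 < t) :
    sqrtDensity s • (s + t)⁻¹ = (∫ t in Ioi 0, Real.rpowIntegrand₀₁ (1 / 2) t 1)⁻¹ * t⁻¹ *
      Real.rpowIntegrand₀₁ (1 / 2) s t := by
  have hexp : (1 / 2 - 1 : ℝ) = -(1 / 2) := by norm_num
  rw [NNReal.smul_def, smul_eq_mul, coe_sqrtDensity hs,
    Real.rpowIntegrand₀₁_eq_pow_div one_half_mem_Ioo hs.le ht.le, hexp]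
  field_simp

theorem isRepresentingMeasure_sqrtMeasure : IsRepresentingMeasure Real.sqrt sqrtMeasure := by
  refine ⟨withDensity_absolutelyContinuous _ _ ?_, 0, le_rfl, fun t ht => ?_⟩
  · rw [Measure.restrict_apply measurableSet_Iio, Iio_inter_Ioi, Ioo_self, measure_empty]
  have hintegrand : EqOn (fun s => sqrtDensity s • (s + t)⁻¹) _ (Ioi 0) :=
    fun s hs => sqrtDensity_smul_inv_add hs ht
  constructor
  · rw [sqrtMeasure, integrable_withDensity_iff_integrable_smul measurable_sqrtDensity]
    exact (integrableOn_congr_fun hintegrand measurableSet_Ioi).2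
      ((Real.integrableOn_rpowIntegrand₀₁_Ioi one_half_mem_Ioo ht.le).const_mul _)
  · have hsqrt := Real.rpow_eq_const_mul_integral one_half_mem_Ioo ht.le
    rw [← Real.sqrt_eq_rpow] at hsqrt
    rw [zero_add, sqrtMeasure, integral_withDensity_eq_integral_smul measurable_sqrtDensity,
      setIntegral_congr_fun measurableSet_Ioi hintegrand, integral_const_mul, mul_right_comm,
      ← hsqrt, ← div_eq_mul_inv, Real.sqrt_div_self', one_div]

theorem encard_support_sqrtMeasure : sqrtMeasure.support.encard = ⊤ := by
  have hac : volume.restrict (Ioi 0) ≪ sqrtMeasure := by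
    refine withDensity_absolutelyContinuous'
      measurable_sqrtDensity.coe_nnreal_ennreal.aemeasurable ?_
    filter_upwards [ae_restrict_mem measurableSet_Ioi] with s hs
    exact_mod_cast (coe_sqrtDensity_pos hs).ne'
  rw [encard_eq_top_iff]
  refine (Ioi_infinite (0 : ℝ)).mono fun s hs => hac.support_mono ?_
  exact Measure.interior_inter_support
    ⟨by rwa [interior_Ioi], by rw [Measure.support_eq_univ]; trivial⟩

end SquareRoot

section Reversibility

variable {n m : ℕ} {A : Alg n} {B : Alg m} {T : A →ₗ[ℂ] B} {S : Set A} {ρ x : A} {s : ℝ}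

lemma finrank_alg_le (A : Alg n) : Module.finrank ℂ A ≤ n ^ 2 := by
  simpa [Module.finrank_matrix, sq] using
    LinearMap.finrank_le_finrank_of_injective (f := A.subtype.toAlgHom.toLinearMap)
      Subtype.coe_injective

lemma finrank_prod_alg_le (A : Alg n) (B : Alg m) :
    Module.finrank ℂ (B × A) ≤ n ^ 2 + m ^ 2 := by
  rw [Module.finrank_prod, add_comm]
  exact add_le_add (finrank_alg_le A) (finrank_alg_le B)

lemma sub_mem_Lin {σ₁ σ₂ : A} (h₁ : σ₁ ∈ S) (h₂ : σ₂ ∈ S) : σ₁ - σ₂ ∈ Lin S :=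
  Submodule.subset_span ⟨σ₁, h₁, σ₂, h₂, rfl⟩

lemma isTangent_of_mem_Lin (hS : ∀ σ ∈ S, IsDensity σ) (hx : x ∈ Lin S) : IsTangent x := by
  have hle : Lin S ≤ selfAdjoint.submodule ℝ A ⊓ LinearMap.ker (tr.restrictScalars ℝ) := by
    refine Submodule.span_le.2 ?_
    rintro _ ⟨σ₁, h₁, σ₂, h₂, rfl⟩
    refine ⟨IsSelfAdjoint.sub (star_eq_of_posSemidef (hS σ₁ h₁).1)
      (star_eq_of_posSemidef (hS σ₂ h₂).1), ?_⟩
    exact (map_sub tr σ₁ σ₂).trans (sub_eq_zero.2 ((hS σ₁ h₁).2.trans (hS σ₂ h₂).2.symm))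
  exact hle hx

lemma IsTangent.map (hT : IsUnitalSchwarz (hsAdjoint T)) (hx : IsTangent x) : IsTangent (T x) :=
  ⟨(map_star_of_hsAdjoint hT.map_star x).symm.trans (congrArg T hx.1),
    (tr_map_of_hsAdjoint hT.1 x).trans hx.2⟩

lemma IsDensity.map (hT : IsUnitalSchwarz (hsAdjoint T)) (hρ : IsDensity ρ) : IsDensity (T ρ) :=
  ⟨posSemidef_map_of_hsAdjoint hT.posSemidef_map hρ.1, (tr_map_of_hsAdjoint hT.1 ρ).trans hρ.2⟩

lemma invForm_self (hs₀ : 0 ≤ s) (hρ : (ρ : Op n).PosDef) :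
    invForm s ρ ρ = ((s + 1 : ℝ) : ℂ)⁻¹ * tr ρ := by
  have hs : ((s + 1 : ℝ) : ℂ) ≠ 0 := by exact_mod_cast (by positivity : s + 1 ≠ 0)
  have hone : mulSumInv s ρ ρ = ((s + 1 : ℝ) : ℂ)⁻¹ • 1 := mulSum_injective hs₀ hρ <| by
    have hsum : mulSum s ρ 1 = ((s + 1 : ℝ) : ℂ) • ρ := by
      rw [mulSum_apply, one_mul, mul_one, Complex.ofReal_add, Complex.ofReal_one, add_smul,
        one_smul]
    rw [mulSum_mulSumInv hs₀ hρ, map_smul, hsum, inv_smul_smul₀ hs]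
  rw [invForm, hone, hs_eq_tr, star_smul, star_one, smul_one_mul, map_smul, smul_eq_mul,
    RCLike.star_def, map_inv₀, Complex.conj_ofReal]

lemma invForm_map_self (hT : IsUnitalSchwarz (hsAdjoint T)) (hρ : (ρ : Op n).PosDef)
    (hτ : (T ρ : Op m).PosDef) (hs₀ : 0 ≤ s) : invForm s (T ρ) (T ρ) = invForm s ρ ρ := by
  rw [invForm_self hs₀ hρ, invForm_self hs₀ hτ, tr_map_of_hsAdjoint hT.1]

theorem IsReversible.invForm_map_eq (h : IsReversible T S) (hT : IsUnitalSchwarz (hsAdjoint T))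
    (hρS : ρ ∈ S) (hρ : (ρ : Op n).PosDef) (hτ : (T ρ : Op m).PosDef) (hx : x ∈ Lin S)
    (hs₀ : 0 ≤ s) : invForm s (T ρ) (T x) = invForm s ρ x := by
  obtain ⟨R, hR, hRT⟩ := h
  have hle : Lin S ≤ LinearMap.eqLocus ((R ∘ₗ T).restrictScalars ℝ) LinearMap.id := by
    refine Submodule.span_le.2 ?_
    rintro _ ⟨σ₁, h₁, σ₂, h₂, rfl⟩
    change R (T (σ₁ - σ₂)) = σ₁ - σ₂
    rw [map_sub, map_sub, hRT σ₁ h₁, hRT σ₂ h₂]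
  have hRx : R (T x) = x := hle hx
  have hRρ : R (T ρ) = ρ := hRT ρ hρS
  refine (invForm_map_le hT hs₀ hρ hτ x).antisymm ?_
  simpa only [hRρ, hRx] using invForm_map_le hR hs₀ hτ (hRρ.symm ▸ hρ) (T x)

theorem isReversible_of_invForm_map_eq (hT : IsUnitalSchwarz (hsAdjoint T))
    (hρ : (ρ : Op n).PosDef) (hτ : (T ρ : Op m).PosDef)
    (h : ∀ σ ∈ S, ∀ s : ℝ, 0 < s → invForm s (T ρ) (T (σ - ρ)) = invForm s ρ (σ - ρ)) :
    IsReversible T S := by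
  obtain ⟨_, R, -, ⟨hcp, htr⟩, hR⟩ := exists_channels hT hρ hτ
  refine ⟨R, isUnitalSchwarz_hsAdjoint hcp htr, fun σ hσ => ?_⟩
  have hRρ := (hR ρ fun s hs => invForm_map_self hT hρ hτ hs.le).2
  simpa only [map_sub, hRρ, sub_left_inj] using (hR (σ - ρ) (h σ hσ)).2

theorem IsMonotoneMetric.map_eq {g : ∀ (k : ℕ) (C : Alg k), C → C → C → ℝ}
    (hg : IsMonotoneMetric g) (hT : IsUnitalSchwarz (hsAdjoint T)) (hρ : IsDensity ρ)
    (hu : IsUnit ρ) (hTu : IsUnit (T ρ)) (hx : IsTangent x)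
    (h : ∀ s : ℝ, 0 < s → invForm s (T ρ) (T x) = invForm s ρ x) :
    g n A ρ x x = g m B (T ρ) (T x) (T x) := by
  have hpd := posDef_of_isUnit hρ.1 hu
  have hτ := hT.posDef_map hρ.1 hTu
  obtain ⟨Ψ, R, ⟨hΨcp, hΨtr⟩, ⟨hRcp, hRtr⟩, hΨR⟩ := exists_channels hT hpd hτ
  obtain ⟨hΨρ, hRρ⟩ := hΨR ρ fun s hs => invForm_map_self hT hpd hτ hs.le
  obtain ⟨hΨx, hRx⟩ := hΨR x h
  refine le_antisymm ?_ ?_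
  · simpa only [hRρ, hRx] using hg.monotone m n B A R hRcp hRtr (T ρ) (hρ.map hT) hTu
      (hRρ.symm ▸ hu) (T x) (hx.map hT)
  · simpa only [hΨρ, hΨx] using hg.monotone n m A B Ψ hΨcp hΨtr ρ hρ hu (hΨρ.symm ▸ hTu) x hx

theorem invForm_eq_of_forall_isMonotoneMetric {τ y : B} (hρ : (ρ : Op n).PosDef)
    (hτ : (τ : Op m).PosDef) (h : ∀ g : (∀ (k : ℕ) (C : Alg k), C → C → C → ℝ),
      IsMonotoneMetric g → g n A ρ x x = g m B τ y y) (hs₀ : 0 ≤ s) :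
    invForm s τ y = invForm s ρ x := by
  have hre : (invForm s ρ x).re = (invForm s τ y).re :=
    h _ (isMonotoneMetric_re_hs_mulSumInv hs₀)
  have him := (Complex.nonneg_iff.1 (invForm_nonneg hs₀ hρ x)).2
  have him' := (Complex.nonneg_iff.1 (invForm_nonneg hs₀ hτ y)).2
  exact Complex.ext hre.symm (him'.symm.trans him)

theorem invForm_map_eq_of_metric_eq (hT : IsUnitalSchwarz (hsAdjoint T))
    (hρ : (ρ : Op n).PosDef) (hτ : (T ρ : Op m).PosDef) (hx : IsTangent x) {f : ℝ → ℝ}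
    (hf : ∀ t, 0 < t → 0 < f t) {ν : MeasureTheory.Measure ℝ} (hν : IsRepresentingMeasure f ν)
    (hcard : ((n ^ 2 + m ^ 2 : ℕ) : ℕ∞) ≤ ν.support.encard)
    (h : metric f (ρ : Op n) x x = metric f (T ρ : Op m) (T x) (T x)) (hs₀ : 0 ≤ s) :
    invForm s (T ρ) (T x) = invForm s ρ x := by
  have hsupport (r : ℝ) (hr : r ∈ ν.support) := invForm_eq_of_mem_support hρ hτ hx.1
    (hx.map hT).1 (fun q hq => invForm_map_le hT hq hρ hτ x) hf hν h hr
  exact invForm_map_eq_of_finrank_le_encard hT hρ hτ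
    ((Nat.cast_le.2 (finrank_prod_alg_le A B)).trans hcard) (fun r hr => (hsupport r hr).1)
    (fun r hr => (hsupport r hr).2) hs₀

lemma chiSq_map_eq_iff (f : ℝ → ℝ) (T : A →ₗ[ℂ] B) (σ ρ : A) :
    chiSq f (σ : Op n) ρ = chiSq f (T σ : Op m) (T ρ) ↔
      metric f (ρ : Op n) (σ - ρ : A) (σ - ρ : A) =
        metric f (T ρ : Op m) (T (σ - ρ)) (T (σ - ρ)) := by
  rw [map_sub]
  rfl

end Reversibility

end QuantumReversibility

theorem theorem7_general {n m : ℕ} (A : Alg n) (B : Alg m) (T : A →ₗ[ℂ] B) (S : Set A)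
    (hS : ∀ σ ∈ S, IsDensity σ) (ρ : A) (hρS : ρ ∈ S) (hρ : IsUnit ρ) (hTρ : IsUnit (T ρ))
    (hT : IsUnitalSchwarz (hsAdjoint T)) :
    List.TFAE [
      IsReversible T S,
      ∀ g : (∀ (k : ℕ) (C : Alg k), C → C → C → ℝ), IsMonotoneMetric g →
        ∀ x ∈ Lin S, g n A ρ x x = g m B (T ρ) (T x) (T x),
      ∀ f : ℝ → ℝ, IsSymmOperatorMonotone f →
        ∀ x ∈ Lin S, metric f (ρ : Op n) x x = metric f (T ρ : Op m) (T x) (T x),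
      ∀ f : ℝ → ℝ, IsSymmOperatorMonotone f →
        ∀ σ ∈ S, chiSq f (σ : Op n) ρ = chiSq f (T σ : Op m) (T ρ),
      ∃ f : ℝ → ℝ, IsSymmOperatorMonotone f ∧
        (∃ ν : MeasureTheory.Measure ℝ, IsRepresentingMeasure f ν ∧
          ((n ^ 2 + m ^ 2 : ℕ) : ℕ∞) ≤ ν.support.encard) ∧
        ∀ x ∈ Lin S, metric f (ρ : Op n) x x = metric f (T ρ : Op m) (T x) (T x),
      ∃ f : ℝ → ℝ, IsSymmOperatorMonotone f ∧
        (∃ ν : MeasureTheory.Measure ℝ, IsRepresentingMeasure f ν ∧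
          ((n ^ 2 + m ^ 2 : ℕ) : ℕ∞) ≤ ν.support.encard) ∧
        ∀ σ ∈ S, chiSq f (σ : Op n) ρ = chiSq f (T σ : Op m) (T ρ)] := by
  have hpd := posDef_of_isUnit (hS ρ hρS).1 hρ
  have hτ := hT.posDef_map (hS ρ hρS).1 hTρ
  have htan {x : A} (hx : x ∈ Lin S) := isTangent_of_mem_Lin hS hx
  have hLin {σ : A} (hσ : σ ∈ S) : σ - ρ ∈ Lin S := sub_mem_Lin hσ hρS
  have hsqrt : ∃ ν, IsRepresentingMeasure Real.sqrt ν ∧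
      ((n ^ 2 + m ^ 2 : ℕ) : ℕ∞) ≤ ν.support.encard :=
    ⟨_, isRepresentingMeasure_sqrtMeasure, encard_support_sqrtMeasure ▸ le_top⟩
  tfae_have 1 → 2 := fun h g hg x hx => hg.map_eq hT (hS ρ hρS) hρ hTρ (htan hx)
    fun s hs => h.invForm_map_eq hT hρS hpd hτ hx hs.le
  tfae_have 2 → 1 := fun h => isReversible_of_invForm_map_eq hT hpd hτ fun σ hσ s hs =>
    invForm_eq_of_forall_isMonotoneMetric hpd hτ (fun g hg => h g hg _ (hLin hσ)) hs.le
  tfae_have 1 → 3 := fun h f hf x hx =>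
    metric_eq_of_forall_invForm_eq hpd hτ (htan hx).1 ((htan hx).map hT).1
      (fun s hs => h.invForm_map_eq hT hρS hpd hτ hx hs.le) hf.pos
  tfae_have 3 → 4 := fun h f hf σ hσ => (chiSq_map_eq_iff f T σ ρ).2 (h f hf _ (hLin hσ))
  tfae_have 3 → 5 := fun h =>
    ⟨Real.sqrt, isSymmOperatorMonotone_sqrt, hsqrt, h _ isSymmOperatorMonotone_sqrt⟩
  tfae_have 4 → 6 := fun h =>
    ⟨Real.sqrt, isSymmOperatorMonotone_sqrt, hsqrt, h _ isSymmOperatorMonotone_sqrt⟩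
  tfae_have 5 → 6 := fun ⟨f, hf, hν, h⟩ =>
    ⟨f, hf, hν, fun σ hσ => (chiSq_map_eq_iff f T σ ρ).2 (h _ (hLin hσ))⟩
  tfae_have 6 → 1 := fun ⟨_, hf, ⟨_, hν, hcard⟩, h⟩ =>
    isReversible_of_invForm_map_eq hT hpd hτ fun σ hσ _ hs =>
      invForm_map_eq_of_metric_eq hT hpd hτ (htan (hLin hσ)) hf.pos hν hcard
        ((chiSq_map_eq_iff _ T σ ρ).1 (h σ hσ)) hs.le
  tfae_finish

theorem theorem7 {n m : ℕ} (A : Alg n) (B : Alg m) (T : A →ₗ[ℂ] B) (S : Set A)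
    (hS : ∀ σ ∈ S, IsDensity σ) (ρ : A) (hρS : ρ ∈ S) (hρ : IsUnit ρ) (hTρ : IsUnit (T ρ))
    (hT : IsUnitalSchwarz (hsAdjoint T)) (hTdual : IsUnitalSchwarz (petzDual T ρ)) :
    List.TFAE [
      IsReversible T S,
      ∀ g : (∀ (k : ℕ) (C : Alg k), C → C → C → ℝ), IsMonotoneMetric g →
        ∀ x ∈ Lin S, g n A ρ x x = g m B (T ρ) (T x) (T x),
      ∀ f : ℝ → ℝ, IsSymmOperatorMonotone f →
        ∀ x ∈ Lin S, metric f (ρ : Op n) x x = metric f (T ρ : Op m) (T x) (T x),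
      ∀ f : ℝ → ℝ, IsSymmOperatorMonotone f →
        ∀ σ ∈ S, chiSq f (σ : Op n) ρ = chiSq f (T σ : Op m) (T ρ),
      ∃ f : ℝ → ℝ, IsSymmOperatorMonotone f ∧
        (∃ ν : MeasureTheory.Measure ℝ, IsRepresentingMeasure f ν ∧
          ((n ^ 2 + m ^ 2 : ℕ) : ℕ∞) ≤ ν.support.encard) ∧
        ∀ x ∈ Lin S, metric f (ρ : Op n) x x = metric f (T ρ : Op m) (T x) (T x),
      ∃ f : ℝ → ℝ, IsSymmOperatorMonotone f ∧
        (∃ ν : MeasureTheory.Measure ℝ, IsRepresentingMeasure f ν ∧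
          ((n ^ 2 + m ^ 2 : ℕ) : ℕ∞) ≤ ν.support.encard) ∧
        ∀ σ ∈ S, chiSq f (σ : Op n) ρ = chiSq f (T σ : Op m) (T ρ)] :=
  theorem7_general A B T S hS ρ hρS hρ hTρ hT
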